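/- Let $\lambda\in(\sqrt2,2)$, $T(x)=\min(\lambda x,\lambda(1-x))$, $c=\tfrac12$, $b=T(c)$, $a=T(b)$, $I=[a,b]$, and let $f=T|_I\colon I\to I$ be the core tent map. Let $\hat a\in[c,b]$ be the point with $f(\hat a)=f(a)$. Let $$\hat I=\{\mathbf x=\langle x_0,x_1,\dots\rangle\in I^{\mathbb N} : f(x_{r+1})=x_r \text{ for all } r\ge 0\}$$ with the product topology, and let $\hat f\colon\hat I\to\hat I$, $\hat f(\langle x_0,x_1,\dots\rangle)=\langle f(x_0),x_0,x_1,\dots\rangle$, be the natural extension. *Extreme elements.* A sequence $s\in\{0,1\}^{\mathbb N}$ is an itinerary of $\mathbf x\in\hat I$ if $s_r=0\Rightarrow x_{r+1}\le c$ and $s_r=1\Rightarrow x_{r+1}\ge c$, for all $r\ge0$. Order $\{0,1\}^{\mathbb N}$ by the unimodal order: for $s\ne t$, with $r$ least such that $s_r\neq t_r$, put $s\prec t$ if and only if $\sum_{i=0}^r s_i$ is even. For $x\in I$, the set of itineraries of elements $\mathbf x\in\hat I$ with $x_0=x$ has a greatest and a least element; let $e(x_u)$ and $e(x_\ell)$ be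 the elements of $\hat I$ above $x$ that have these as itineraries. *Circle and outside map.* Let $S$ be the circle obtained by gluing two copies $\{x_\ell\}$ and $\{x_u\}$ of $I$ at their endpoints ($a_\ell=a_u=a$, $b_\ell=b_u=b$), oriented so that the positive direction runs from $a$ to $b$ through the points $x_\ell$ and from $b$ to $a$ through the points $x_u$. Since $e(a_\ell)=e(a_u)$ and $e(b_\ell)=e(b_u)$, this gives a map $e\colon S\to\hat I$. The outside map $B\colon S\to S$ is the continuous monotone map of degree one given by $B(x_\ell)=f(x)_\ell$ for $x\in[a,c]$, $B(x_\ell)=f(x)_u$ for $x\in[c,b]$, $B(x_u)=f(x)_\ell$ for $x\in(\hat a,b]$, and $B=f(a)_\ell$ on the arc $[\hat a_u,a]$. Let $\tilde B$ be the restriction of $B$ to the arc $[a,\hat a_u)$. The height of $f$ is the Poincaré rotation number of $B$. For $y\in S$, $\mathrm{orb}(y,\tilde B)$ is the set of those points $\tilde B^r(y)$, $r\ge0$, that are defined; for $\mathbf x\in\hat I$, $\mathrm{orb}(\mathbf x,\hat f)=\{\hat f^r(\mathbf x): r\ge0\}$. Put $$\mathcal C_S=\overline{\mathrm{orb}(f(a)_\ell,\tilde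 B)}\subset S,\qquad \mathcal C=\overline{e(\mathcal C_S)}\subset\hat I .$$ **Theorem.** Suppose that the height of $f$ is irrational. Then $\mathcal C$ is a Cantor set (non-empty, compact, perfect and totally disconnected), it is $\hat f$-invariant, $\hat f(\mathcal C)=\mathcal C$, and $$\mathcal C=e(\mathcal C_S)\cup\{\hat f^r(e(\hat a_u)) : r\ge1\}.$$ Moreover $\mathrm{orb}(e(f(a)_\ell),\hat f)$ is contained and dense in $\mathcal C$. -/

import Mathlib

noncomputable section

namespace TentMap

open Set

/-! ## Core tent maps -/

/-- The slopes `λ ∈ (√2, 2)`. -/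
abbrev Slope : Type := Set.Ioo (Real.sqrt 2) 2

theorem Slope.one_lt (lam : Slope) : 1 < lam.1 :=
  lt_trans (by rw [Real.lt_sqrt] <;> norm_num) lam.2.1

theorem Slope.lt_two (lam : Slope) : lam.1 < 2 := lam.2.2

/-- The full tent map `T_λ(x) = min(λx, λ(1-x))`. -/
def tent (lam x : ℝ) : ℝ := min (lam * x) (lam * (1 - x))

/-- The turning point. -/
def crit : ℝ := 1 / 2

/-- `a = T_λ²(c)`. -/
def leftEnd (lam : Slope) : ℝ := tent lam (tent lam crit)

/-- `b = T_λ(c)`. -/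
def rightEnd (lam : Slope) : ℝ := tent lam crit

theorem rightEnd_eq (lam : Slope) : rightEnd lam = lam.1 / 2 := by
  unfold rightEnd tent crit
  rw [min_eq_left (by linarith)]; ring

theorem leftEnd_eq (lam : Slope) : leftEnd lam = lam.1 * (1 - lam.1 / 2) := by
  have h := rightEnd_eq lam
  unfold rightEnd at h
  have h1 := lam.one_lt
  unfold leftEnd
  rw [h]; unfold tent
  rw [min_eq_right (by nlinarith)]

theorem leftEnd_lt_crit (lam : Slope) : leftEnd lam < crit := by
  rw [leftEnd_eq]; unfold crit
  nlinarith [lam.one_lt, mul_pos (sub_pos.2 lam.one_lt) (sub_pos.2 lam.one_lt)]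

theorem crit_lt_rightEnd (lam : Slope) : crit < rightEnd lam := by
  rw [rightEnd_eq]; unfold crit; linarith [lam.one_lt]

theorem leftEnd_lt_rightEnd (lam : Slope) : leftEnd lam < rightEnd lam :=
  (leftEnd_lt_crit lam).trans (crit_lt_rightEnd lam)

theorem leftEnd_pos (lam : Slope) : 0 < leftEnd lam := by
  rw [leftEnd_eq]; nlinarith [lam.one_lt, lam.lt_two]

/-- The interval `I = [a, b]`. -/
abbrev Core (lam : Slope) : Type := Set.Icc (leftEnd lam) (rightEnd lam)

theorem tent_mem (lam : Slope) (x : Core lam) :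
    tent lam x.1 ∈ Set.Icc (leftEnd lam) (rightEnd lam) := by
  obtain ⟨x, hx1, hx2⟩ := x
  have h1 := lam.one_lt
  have h2 := lam.lt_two
  have h3 := leftEnd_pos lam
  have e1 := leftEnd_eq lam
  have e2 := rightEnd_eq lam
  have hx2' : x ≤ lam.1 / 2 := hx2.trans_eq e2
  show leftEnd lam ≤ min (lam.1 * x) (lam.1 * (1 - x)) ∧
    min (lam.1 * x) (lam.1 * (1 - x)) ≤ rightEnd lam
  refine ⟨le_min ?_ ?_, ?_⟩
  · nlinarith
  · rw [e1]; nlinarith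
  · rw [e2]
    rcases le_total x (1 / 2) with h | h
    · exact (min_le_left _ _).trans (by nlinarith)
    · exact (min_le_right _ _).trans (by nlinarith)

/-- The core tent map `f : I → I`. -/
def coreTent (lam : Slope) (x : Core lam) : Core lam := ⟨tent lam x.1, tent_mem lam x⟩

/-- The endpoint `a`, as a point of `I`. -/
def ptA (lam : Slope) : Core lam := ⟨leftEnd lam, le_rfl, (leftEnd_lt_rightEnd lam).le⟩

/-- The endpoint `b`, as a point of `I`. -/
def ptB (lam : Slope) : Core lam := ⟨rightEnd lam, (leftEnd_lt_rightEnd lam).le, le_rfl⟩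

theorem one_sub_mem (lam : Slope) :
    1 - leftEnd lam ∈ Set.Icc (leftEnd lam) (rightEnd lam) := by
  have h1 := lam.one_lt
  have h2 := lam.lt_two
  have h3 := leftEnd_lt_crit lam
  unfold crit at h3
  refine ⟨by linarith, ?_⟩
  rw [leftEnd_eq, rightEnd_eq]
  nlinarith

/-- The point `â = 1 - a`; see `aHat_spec`. -/
def aHat (lam : Slope) : Core lam := ⟨1 - leftEnd lam, one_sub_mem lam⟩

/-- `â` is the point of `[c, b]` with `f(â) = f(a)`. -/
theorem aHat_spec (lam : Slope) (x : Core lam) :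
    (crit ≤ x.1 ∧ coreTent lam x = coreTent lam (ptA lam)) ↔ x = aHat lam := by
  have h1 := lam.one_lt
  have h3 := leftEnd_lt_crit lam
  unfold crit at *
  have hA : tent lam (leftEnd lam) = lam.1 * leftEnd lam := by
    unfold tent; exact min_eq_left (by nlinarith)
  constructor
  · rintro ⟨hx, he⟩
    have he := congrArg Subtype.val he
    simp only [coreTent, ptA, hA] at he
    unfold tent at he
    rw [min_eq_right (by nlinarith)] at he
    apply Subtype.ext
    show x.1 = 1 - leftEnd lam
    have := mul_left_cancel₀ (by linarith) he
    linarith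
  · rintro rfl
    refine ⟨by show _ ≤ 1 - leftEnd lam; linarith, Subtype.ext ?_⟩
    simp only [coreTent, ptA, hA, aHat]
    unfold tent
    rw [min_eq_right (by nlinarith)]; ring

/-! ## The inverse limit and the natural extension -/

/-- The inverse limit `Î ⊆ I^ℕ`, with the topology induced by the product topology. -/
abbrev InvLim (lam : Slope) : Type :=
  {x : ℕ → Core lam // ∀ r, coreTent lam (x (r + 1)) = x r}

theorem continuous_coreTent (lam : Slope) : Continuous (coreTent lam) := by
  unfold coreTent tent; fun_prop

/-- The natural extension `f̂(⟨x₀, x₁, …⟩) = ⟨f(x₀), x₀, x₁, …⟩`. -/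
def natExt (lam : Slope) : InvLim lam ≃ₜ InvLim lam where
  toFun x := ⟨fun r => Nat.casesOn r (coreTent lam (x.1 0)) x.1, by
    rintro (_ | r)
    · rfl
    · exact x.2 r⟩
  invFun x := ⟨fun r => x.1 (r + 1), fun r => x.2 (r + 1)⟩
  left_inv x := rfl
  right_inv x := by
    apply Subtype.ext; funext r
    cases r with
    | zero => exact x.2 0
    | succ r => rfl
  continuous_toFun := by
    refine Continuous.subtype_mk (continuous_pi ?_) _
    rintro (_ | r)
    · exact (continuous_coreTent lam).comp ((continuous_apply 0).comp continuous_subtype_val)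
    · exact (continuous_apply r).comp continuous_subtype_val
  continuous_invFun := by
    refine Continuous.subtype_mk (continuous_pi fun r => ?_) _
    exact (continuous_apply (r + 1)).comp continuous_subtype_val

/-! ## Itineraries and extreme elements of the fibers of `π₀` -/

/-- The unimodal (parity-lexicographical) order on `{0,1}^ℕ`; `true` is `1`, `false` is `0`. -/
def UnimodalLE (s t : ℕ → Bool) : Prop :=
  s = t ∨ ∃ r, (∀ i < r, s i = t i) ∧ s r ≠ t r ∧
    Even (∑ i ∈ Finset.range (r + 1), (s i).toNat)

/-- `s` is an itinerary of `x ∈ Î`. -/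
def IsItinerary {lam : Slope} (s : ℕ → Bool) (x : InvLim lam) : Prop :=
  ∀ r, (s r = false → (x.1 (r + 1)).1 ≤ crit) ∧ (s r = true → crit ≤ (x.1 (r + 1)).1)

/-- The set `K_x` of itineraries realized on the fiber of `π₀` above `x`. -/
def fiberItineraries (lam : Slope) (x : Core lam) : Set (ℕ → Bool) :=
  {s | ∃ z : InvLim lam, z.1 0 = x ∧ IsItinerary s z}

/-- `z` is the upper element of the fiber above `x`: it has the greatest itinerary `U_x` of
`K_x`. -/
def IsUpperElement {lam : Slope} (x : Core lam) (z : InvLim lam) : Prop :=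
  z.1 0 = x ∧ ∃ s, IsItinerary s z ∧ ∀ t ∈ fiberItineraries lam x, UnimodalLE t s

/-- `z` is the lower element of the fiber above `x`: it has the least itinerary `L_x` of
`K_x`. -/
def IsLowerElement {lam : Slope} (x : Core lam) (z : InvLim lam) : Prop :=
  z.1 0 = x ∧ ∃ s, IsItinerary s z ∧ ∀ t ∈ fiberItineraries lam x, UnimodalLE s t

theorem right_preimage_mem (lam : Slope) (x : Core lam) :
    1 - x.1 / lam.1 ∈ Set.Icc (leftEnd lam) (rightEnd lam) := by
  obtain ⟨x, hx1, hx2⟩ := x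
  have h1 := lam.one_lt
  have hc := leftEnd_lt_crit lam
  unfold crit at hc
  have ea := leftEnd_eq lam
  have eb := rightEnd_eq lam
  have u : x / lam.1 ≤ 1 / 2 := by rw [div_le_iff₀ (by linarith)]; linarith
  have l : 1 - lam.1 / 2 ≤ x / lam.1 := by rw [le_div_iff₀ (by linarith)]; linarith
  show leftEnd lam ≤ 1 - x / lam.1 ∧ 1 - x / lam.1 ≤ rightEnd lam
  constructor <;> linarith

/-- The preimage of `x` in `[c, b]`. -/
def rightPre (lam : Slope) (x : Core lam) : Core lam := ⟨1 - x.1 / lam.1, right_preimage_mem lam x⟩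

theorem coreTent_rightPre (lam : Slope) (x : Core lam) : coreTent lam (rightPre lam x) = x := by
  have h1 := lam.one_lt
  have hx2 : x.1 ≤ lam.1 / 2 := x.2.2.trans_eq (rightEnd_eq lam)
  have u : x.1 / lam.1 ≤ 1 / 2 := by rw [div_le_iff₀ (by linarith)]; linarith
  apply Subtype.ext
  show tent lam (1 - x.1 / lam.1) = x.1
  unfold tent
  rw [min_eq_right (by nlinarith)]
  field_simp; ring

/-- Pairs (point of the fiber above `x`, itinerary of it). -/
def fiberPairs (lam : Slope) (x : Core lam) : Set ((ℕ → Core lam) × (ℕ → Bool)) :=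
  {p | p.1 0 = x ∧ ∀ r, coreTent lam (p.1 (r + 1)) = p.1 r ∧
    ((p.2 r = false → (p.1 (r + 1)).1 ≤ crit) ∧ (p.2 r = true → crit ≤ (p.1 (r + 1)).1))}

theorem isCompact_fiberPairs (lam : Slope) (x : Core lam) : IsCompact (fiberPairs lam x) := by
  apply IsClosed.isCompact
  have hcoord : ∀ r, Continuous fun p : (ℕ → Core lam) × (ℕ → Bool) => p.1 r := fun r =>
    (continuous_apply r).comp continuous_fst
  have hb : ∀ r, Continuous fun p : (ℕ → Core lam) × (ℕ → Bool) => p.2 r := fun r =>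
    (continuous_apply r).comp continuous_snd
  have hop : ∀ (r : ℕ) (v : Bool),
      IsOpen {p : (ℕ → Core lam) × (ℕ → Bool) | p.2 r = v} := fun r v =>
    (isOpen_discrete {v}).preimage (hb r)
  have : fiberPairs lam x = {p | p.1 0 = x} ∩ ⋂ r, ({p | coreTent lam (p.1 (r + 1)) = p.1 r} ∩
      ({p | p.2 r = false → (p.1 (r + 1)).1 ≤ crit} ∩
        {p | p.2 r = true → crit ≤ (p.1 (r + 1)).1})) := by
    ext p; simp [fiberPairs]
  rw [this]
  refine (isClosed_eq (hcoord 0) continuous_const).inter (isClosed_iInter fun r => ?_)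
  refine (isClosed_eq ((continuous_coreTent lam).comp (hcoord _)) (hcoord r)).inter
    (IsClosed.inter ?_ ?_)
  · exact isClosed_imp (hop r _)
      (isClosed_le (continuous_subtype_val.comp (hcoord _)) continuous_const)
  · exact isClosed_imp (hop r _)
      (isClosed_le continuous_const (continuous_subtype_val.comp (hcoord _)))

theorem fiberPairs_nonempty (lam : Slope) (x : Core lam) : (fiberPairs lam x).Nonempty := by
  refine ⟨(fun r => (rightPre lam)^[r] x, fun _ => true), rfl, fun r => ⟨?_, ?_, ?_⟩⟩
  · show coreTent lam ((rightPre lam)^[r + 1] x) = (rightPre lam)^[r] x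
    rw [Function.iterate_succ_apply', coreTent_rightPre]
  · simp
  · intro _
    simp only [Function.iterate_succ_apply']
    set y := (rightPre lam)^[r] x
    have h1 := lam.one_lt
    have hx2 : y.1 ≤ lam.1 / 2 := y.2.2.trans_eq (rightEnd_eq lam)
    have u : y.1 / lam.1 ≤ 1 / 2 := by rw [div_le_iff₀ (by linarith)]; linarith
    show (1 : ℝ) / 2 ≤ 1 - y.1 / lam.1
    linarith

/-- The digits of an order embedding of `{0,1}^ℕ`, with the unimodal order, into `ℝ`. -/
def parityDigit (s : ℕ → Bool) (r : ℕ) : ℝ :=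
  if Even (∑ i ∈ Finset.range (r + 1), (s i).toNat) then 0 else 1

/-- An order embedding of `{0,1}^ℕ`, with the unimodal order, into `ℝ`. -/
def cantorCode (s : ℕ → Bool) : ℝ := ∑' r, parityDigit s r * (1 / 3 : ℝ) ^ r

theorem parityDigit_mem (s : ℕ → Bool) (r : ℕ) : 0 ≤ parityDigit s r ∧ parityDigit s r ≤ 1 := by
  unfold parityDigit; split_ifs <;> norm_num

theorem summable_third : Summable fun r : ℕ => (1 / 3 : ℝ) ^ r :=
  summable_geometric_of_lt_one (by norm_num) (by norm_num)

theorem even_flip (n : ℕ) {u v : Bool} (h : u ≠ v) :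
    Even (n + u.toNat) ↔ ¬ Even (n + v.toNat) := by
  cases u <;> cases v <;> simp_all [Nat.even_add_one]

theorem summable_code (s : ℕ → Bool) :
    Summable fun r => parityDigit s r * (1 / 3 : ℝ) ^ r := by
  refine Summable.of_nonneg_of_le (fun r => ?_) (fun r => ?_) summable_third
  · exact mul_nonneg (parityDigit_mem s r).1 (by positivity)
  · exact mul_le_of_le_one_left (by positivity) (parityDigit_mem s r).2

theorem tail_le (s : ℕ → Bool) (r : ℕ) :
    ∑' i, parityDigit s (i + (r + 1)) * (1 / 3 : ℝ) ^ (i + (r + 1)) ≤ (1 / 3 : ℝ) ^ r / 2 := by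
  have hg : HasSum (fun i : ℕ => (1 / 3 : ℝ) ^ i * (1 / 3 : ℝ) ^ (r + 1))
      ((1 - 1 / 3 : ℝ)⁻¹ * (1 / 3 : ℝ) ^ (r + 1)) :=
    (hasSum_geometric_of_lt_one (by norm_num) (by norm_num)).mul_right _
  have he : (1 - 1 / 3 : ℝ)⁻¹ * (1 / 3 : ℝ) ^ (r + 1) = (1 / 3 : ℝ) ^ r / 2 := by
    rw [pow_succ]; ring
  rw [← he]
  refine hasSum_le (fun i => ?_) ((summable_nat_add_iff (r + 1)).2 (summable_code s)).hasSum hg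
  rw [← pow_add]
  exact mul_le_of_le_one_left (by positivity) (parityDigit_mem s _).2

theorem continuous_cantorCode : Continuous cantorCode := by
  refine continuous_tsum (u := fun r => (1 / 3 : ℝ) ^ r) (fun r => ?_) summable_third
    (fun r s => ?_)
  · refine Continuous.mul ?_ continuous_const
    have h : Continuous fun s : ℕ → Bool => ∑ i ∈ Finset.range (r + 1), (s i).toNat :=
      continuous_finsetSum _ fun i _ =>
        (continuous_of_discreteTopology (f := Bool.toNat)).comp (continuous_apply i)
    exact (continuous_of_discreteTopology (f := fun n : ℕ => if Even n then (0 : ℝ) else 1)).comp h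
  · rw [norm_mul, Real.norm_of_nonneg (parityDigit_mem s r).1,
      Real.norm_of_nonneg (by positivity)]
    exact mul_le_of_le_one_left (by positivity) (parityDigit_mem s r).2

theorem cantorCode_lt {s t : ℕ → Bool} (r : ℕ) (h : ∀ i < r, s i = t i) (hne : s r ≠ t r)
    (he : Even (∑ i ∈ Finset.range (r + 1), (s i).toNat)) : cantorCode s < cantorCode t := by
  have hs := (summable_code s).sum_add_tsum_nat_add (r + 1)
  have ht := (summable_code t).sum_add_tsum_nat_add (r + 1)
  have hsumlt : ∀ k ≤ r, ∑ i ∈ Finset.range k, (s i).toNat = ∑ i ∈ Finset.range k, (t i).toNat :=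
    fun k hk => Finset.sum_congr rfl fun i hi => by
      rw [h i (lt_of_lt_of_le (Finset.mem_range.1 hi) hk)]
  have hdig : ∀ i < r, parityDigit s i = parityDigit t i := fun i hi => by
    unfold parityDigit; rw [hsumlt (i + 1) hi]
  have hs0 : parityDigit s r = 0 := by unfold parityDigit; rw [if_pos he]
  have ht1 : parityDigit t r = 1 := by
    unfold parityDigit; rw [if_neg]
    rw [Finset.sum_range_succ, ← hsumlt r le_rfl]
    rw [Finset.sum_range_succ] at he
    exact (even_flip _ hne).1 he
  have htail := tail_le s r
  have htail' : 0 ≤ ∑' i, parityDigit t (i + (r + 1)) * (1 / 3 : ℝ) ^ (i + (r + 1)) :=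
    tsum_nonneg fun i => mul_nonneg (parityDigit_mem t _).1 (by positivity)
  have hfin : ∑ i ∈ Finset.range r, parityDigit s i * (1 / 3 : ℝ) ^ i =
      ∑ i ∈ Finset.range r, parityDigit t i * (1 / 3 : ℝ) ^ i :=
    Finset.sum_congr rfl fun i hi => by rw [hdig i (Finset.mem_range.1 hi)]
  rw [Finset.sum_range_succ] at hs ht
  have hp : (0 : ℝ) < (1 / 3 : ℝ) ^ r := by positivity
  unfold cantorCode
  rw [← hs, ← ht, hfin, hs0, ht1]
  linarith

theorem unimodalLE_of_code {s t : ℕ → Bool} (h : cantorCode s ≤ cantorCode t) :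
    UnimodalLE s t := by
  by_cases hst : s = t
  · exact Or.inl hst
  right
  have hex : ∃ r, s r ≠ t r := Function.ne_iff.1 hst
  have hlt : ∀ i < Nat.find hex, s i = t i := fun i hi => not_not.1 (Nat.find_min hex hi)
  refine ⟨Nat.find hex, hlt, Nat.find_spec hex, ?_⟩
  by_contra hodd
  refine absurd h (not_le.2 (cantorCode_lt (Nat.find hex) (fun i hi => (hlt i hi).symm)
    (Nat.find_spec hex).symm ?_))
  have hne := Nat.find_spec hex
  rw [Finset.sum_range_succ] at hodd ⊢
  rw [Finset.sum_congr rfl fun i hi => by rw [← hlt i (Finset.mem_range.1 hi)]]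
  exact not_not.1 fun h' => hodd ((even_flip _ hne).2 h')

theorem exists_upper (lam : Slope) (x : Core lam) : ∃ z, IsUpperElement x z := by
  obtain ⟨p, hp, hmax⟩ := (isCompact_fiberPairs lam x).exists_isMaxOn (fiberPairs_nonempty lam x)
    (continuous_cantorCode.comp continuous_snd).continuousOn
  refine ⟨⟨p.1, fun r => (hp.2 r).1⟩, hp.1, p.2, fun r => (hp.2 r).2, ?_⟩
  rintro t ⟨z, hz, ht⟩
  exact unimodalLE_of_code
    (hmax (show (z.1, t) ∈ fiberPairs lam x from ⟨hz, fun r => ⟨z.2 r, ht r⟩⟩))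

theorem exists_lower (lam : Slope) (x : Core lam) : ∃ z, IsLowerElement x z := by
  obtain ⟨p, hp, hmin⟩ := (isCompact_fiberPairs lam x).exists_isMinOn (fiberPairs_nonempty lam x)
    (continuous_cantorCode.comp continuous_snd).continuousOn
  refine ⟨⟨p.1, fun r => (hp.2 r).1⟩, hp.1, p.2, fun r => (hp.2 r).2, ?_⟩
  rintro t ⟨z, hz, ht⟩
  exact unimodalLE_of_code
    (hmin (show (z.1, t) ∈ fiberPairs lam x from ⟨hz, fun r => ⟨z.2 r, ht r⟩⟩))

/-- The upper element of the fiber above `x`. -/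
def upperElement (lam : Slope) (x : Core lam) : InvLim lam := (exists_upper lam x).choose

/-- The lower element of the fiber above `x`. -/
def lowerElement (lam : Slope) (x : Core lam) : InvLim lam := (exists_lower lam x).choose

/-! ## The circle `S` -/

/-- The circle `S`: two copies of `I` glued at their endpoints, parametrized by `ℝ/ℤ`. The lower
copy is traversed from `a` to `b` on `[0, 1/2]`, and the upper one from `b` to `a` on
`[1/2, 1]`. -/
abbrev Circ : Type := UnitAddCircle

/-- The coordinate in `[0, 1/2]` of a point of `I`. -/
def coord (lam : Slope) (x : Core lam) : ℝ :=
  (x.1 - leftEnd lam) / (2 * (rightEnd lam - leftEnd lam))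

/-- The point `x_ℓ` of the lower copy of `I`. -/
def low (lam : Slope) (x : Core lam) : Circ := ((coord lam x : ℝ) : UnitAddCircle)

/-- The point `x_u` of the upper copy of `I`. -/
def up (lam : Slope) (x : Core lam) : Circ := ((1 - coord lam x : ℝ) : UnitAddCircle)

/-- The representative in `[0, 1)` of a point of `ℝ/ℤ`. -/
def rep (y : Circ) : ℝ := (AddCircle.equivIco (1 : ℝ) 0 y).1

theorem rep_mem (y : Circ) : 0 ≤ rep y ∧ rep y < 1 := by
  have := (AddCircle.equivIco (1 : ℝ) 0 y).2
  simpa [rep] using this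

theorem proj_mem (lam : Slope) (y : Circ) :
    leftEnd lam + 2 * (rightEnd lam - leftEnd lam) * min (rep y) (1 - rep y) ∈
      Set.Icc (leftEnd lam) (rightEnd lam) := by
  have h := leftEnd_lt_rightEnd lam
  obtain ⟨h0, h1⟩ := rep_mem y
  have m0 : 0 ≤ min (rep y) (1 - rep y) := le_min h0 (by linarith)
  have m1 : min (rep y) (1 - rep y) ≤ 1 / 2 := by
    rcases le_total (rep y) (1 / 2) with h | h
    · exact (min_le_left _ _).trans h
    · exact (min_le_right _ _).trans (by linarith)
  constructor <;> nlinarith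

/-- The projection `τ : S → I`, `τ(x_ℓ) = τ(x_u) = x`. -/
def proj (lam : Slope) (y : Circ) : Core lam :=
  ⟨leftEnd lam + 2 * (rightEnd lam - leftEnd lam) * min (rep y) (1 - rep y), proj_mem lam y⟩

/-- `y` lies on the lower copy of `I`, that is, in the arc `[a, b]` of `S`. -/
def OnLower (y : Circ) : Prop := rep y ≤ 1 / 2

theorem rep_coe {t : ℝ} (h0 : 0 ≤ t) (h1 : t < 1) : rep ((t : ℝ) : UnitAddCircle) = t := by
  unfold rep
  rw [AddCircle.equivIco_coe_eq (by simpa using ⟨h0, h1⟩)]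

theorem coe_rep (y : Circ) : ((rep y : ℝ) : UnitAddCircle) = y :=
  (AddCircle.equivIco (1 : ℝ) 0).symm_apply_apply y

theorem coord_mem (lam : Slope) (x : Core lam) : 0 ≤ coord lam x ∧ coord lam x ≤ 1 / 2 := by
  have h := leftEnd_lt_rightEnd lam
  unfold coord
  refine ⟨div_nonneg (by linarith [x.2.1]) (by linarith), ?_⟩
  rw [div_le_iff₀ (by linarith)]; linarith [x.2.2]

theorem coord_spec (lam : Slope) (x : Core lam) :
    leftEnd lam + 2 * (rightEnd lam - leftEnd lam) * coord lam x = x.1 := by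
  have h := sub_pos.2 (leftEnd_lt_rightEnd lam)
  unfold coord; field_simp; ring

theorem rep_low (lam : Slope) (x : Core lam) : rep (low lam x) = coord lam x :=
  rep_coe (coord_mem lam x).1 (by linarith [(coord_mem lam x).2])

theorem onLower_low (lam : Slope) (x : Core lam) : OnLower (low lam x) := by
  unfold OnLower; rw [rep_low]; exact (coord_mem lam x).2

theorem proj_low (lam : Slope) (x : Core lam) : proj lam (low lam x) = x := by
  apply Subtype.ext
  simp only [proj, rep_low]
  rw [min_eq_left (by linarith [(coord_mem lam x).2]), coord_spec]

theorem coord_ptA (lam : Slope) : coord lam (ptA lam) = 0 := by simp [coord, ptA]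

theorem coord_ptB (lam : Slope) : coord lam (ptB lam) = 1 / 2 := by
  have h := sub_pos.2 (leftEnd_lt_rightEnd lam)
  simp only [coord, ptB]; field_simp

/-- `a_ℓ = a_u`. -/
theorem low_ptA (lam : Slope) : low lam (ptA lam) = up lam (ptA lam) := by
  simp only [low, up, coord_ptA, sub_zero, AddCircle.coe_zero]
  exact (AddCircle.coe_period (1 : ℝ)).symm

/-- `b_ℓ = b_u`. -/
theorem low_ptB (lam : Slope) : low lam (ptB lam) = up lam (ptB lam) := by
  simp only [low, up, coord_ptB]; norm_num

theorem rep_up {lam : Slope} {x : Core lam} (hx : x ≠ ptA lam) :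
    rep (up lam x) = 1 - coord lam x := by
  refine rep_coe (by linarith [(coord_mem lam x).2]) ?_
  rcases (coord_mem lam x).1.lt_or_eq with h | h
  · linarith
  · refine absurd (Subtype.ext ?_) hx
    have := coord_spec lam x
    rw [← h] at this
    simp only [ptA]; linarith

theorem proj_up (lam : Slope) (x : Core lam) : proj lam (up lam x) = x := by
  by_cases hx : x = ptA lam
  · subst hx; rw [← low_ptA, proj_low]
  apply Subtype.ext
  simp only [proj, rep_up hx]
  rw [min_eq_right (by linarith [(coord_mem lam x).2])]
  have := coord_spec lam x
  linear_combination this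

theorem low_proj (lam : Slope) {y : Circ} (h : OnLower y) : low lam (proj lam y) = y := by
  have hd := sub_pos.2 (leftEnd_lt_rightEnd lam)
  unfold OnLower at h
  have : coord lam (proj lam y) = rep y := by
    simp only [coord, proj]
    rw [min_eq_left (by linarith)]; field_simp; ring
  rw [low, this, coe_rep]

theorem up_proj (lam : Slope) {y : Circ} (h : ¬ OnLower y) : up lam (proj lam y) = y := by
  have hd := sub_pos.2 (leftEnd_lt_rightEnd lam)
  unfold OnLower at h
  have : 1 - coord lam (proj lam y) = rep y := by
    simp only [coord, proj]
    rw [min_eq_right (by linarith)]; field_simp; ring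
  rw [up, this, coe_rep]

theorem not_onLower_up {lam : Slope} {x : Core lam} (ha : x ≠ ptA lam) (hb : x ≠ ptB lam) :
    ¬ OnLower (up lam x) := by
  unfold OnLower
  rw [rep_up ha, not_le]
  rcases (coord_mem lam x).2.lt_or_eq with h | h
  · linarith
  · refine absurd (Subtype.ext ?_) hb
    have := coord_spec lam x
    rw [h] at this
    simp only [ptB]; linarith

open Classical in
/-- The map `e : S → Î` onto the extreme elements. The two extreme elements above `a`
coincide, and so do those above `b`: see `extreme_low` and `extreme_up`. -/
def extreme (lam : Slope) (y : Circ) : InvLim lam :=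
  if OnLower y then lowerElement lam (proj lam y) else upperElement lam (proj lam y)

theorem extreme_low (lam : Slope) (x : Core lam) : IsLowerElement x (extreme lam (low lam x)) := by
  unfold extreme
  rw [if_pos (onLower_low lam x), proj_low]
  exact (exists_lower lam x).choose_spec

/-- A sequence obtained by changing one term. -/
theorem isItinerary_update {lam : Slope} {s : ℕ → Bool} {z : InvLim lam} (h : IsItinerary s z)
    {k : ℕ} (hk : (z.1 (k + 1)).1 = crit) (v : Bool) : IsItinerary (Function.update s k v) z := by
  intro r
  by_cases hr : r = k
  · subst hr; simp [hk]
  · simpa [Function.update_of_ne hr] using h r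

/-- If `x_{k+1} = c` throughout the fiber and the first `k` symbols are forced, then the lower
element is also the upper one. -/
theorem upper_of_lower {lam : Slope} {x : Core lam} {z : InvLim lam} {k : ℕ} (hk : k ≤ 1)
    (hc : ∀ w : InvLim lam, w.1 0 = x → (w.1 (k + 1)).1 = crit)
    (hf : ∀ t ∈ fiberItineraries lam x, ∀ i < k, t i = true)
    (h : IsLowerElement x z) : IsUpperElement x z := by
  obtain ⟨h0, s, hs, hmin⟩ := h
  refine ⟨h0, Function.update s k (!s k), isItinerary_update hs (hc z h0) _, ?_⟩
  rintro t ⟨w, hw, ht⟩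
  have hsf := hf s ⟨z, h0, hs⟩
  have htf := hf t ⟨w, hw, ht⟩
  have hle := hmin (Function.update t k (s k)) ⟨w, hw, isItinerary_update ht (hc w hw) _⟩
  -- the value of `s` at `k`
  have hsk : s k = decide (k = 1) := by
    have h2 := hmin (Function.update s k (!s k)) ⟨z, h0, isItinerary_update hs (hc z h0) _⟩
    rcases h2 with h2 | ⟨r, hr1, hr2, hr3⟩
    · have := congrFun h2 k
      simp at this
    · have hrk : r = k := by
        by_contra hne
        exact hr2 (by rw [Function.update_of_ne hne])
      subst hrk
      have hr : r = 0 ∨ r = 1 := by omega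
      rcases hr with rfl | rfl
      · rw [Finset.sum_range_one] at hr3
        cases hv : s 0 <;> simp [hv] at hr3 ⊢
      · have h0 := hsf 0 (by norm_num)
        rw [Finset.sum_range_succ, Finset.sum_range_one, h0] at hr3
        cases hv : s 1 <;> simp [hv] at hr3 ⊢
  by_cases htk : t k = s k
  · -- `t` and the new sequence first differ at `k`
    right
    refine ⟨k, fun i hi => ?_, ?_, ?_⟩
    · rw [Function.update_of_ne hi.ne, hsf i hi, htf i hi]
    · simp [htk]
    · have hr : k = 0 ∨ k = 1 := by omega
      rcases hr with rfl | rfl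
      · simp_all
      · have := htf 0 (by norm_num)
        simp_all [Finset.sum_range_succ]
  · have htk' : t k = !s k := by cases h1 : t k <;> cases h2 : s k <;> simp_all
    rcases hle with hle | ⟨r, hr1, hr2, hr3⟩
    · left
      funext i
      by_cases hi : i = k
      · subst hi; simp [htk']
      · rw [Function.update_of_ne hi, hle, Function.update_of_ne hi]
    · right
      have hrk : k < r := by
        rcases lt_trichotomy r k with h | h | h
        · exact absurd (by rw [Function.update_of_ne h.ne, hsf r h, htf r h]) hr2
        · subst h; simp at hr2
        · exact h
      have hagree : ∀ i < r, i ≠ k → t i = s i := fun i hi hik => by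
        have := hr1 i hi
        rw [Function.update_of_ne hik] at this
        exact this.symm
      rw [Function.update_of_ne hrk.ne'] at hr2
      refine ⟨r, fun i hi => ?_, ?_, ?_⟩
      · by_cases hik : i = k
        · subst hik; simp [htk']
        · rw [Function.update_of_ne hik, hagree i hi hik]
      · rw [Function.update_of_ne hrk.ne']; exact hr2.symm
      · rw [Finset.sum_range_succ] at hr3 ⊢
        have hmem : k ∈ Finset.range r := Finset.mem_range.2 hrk
        rw [← Finset.add_sum_erase _ _ hmem] at hr3 ⊢
        have heq : ∑ i ∈ (Finset.range r).erase k, (t i).toNat =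
            ∑ i ∈ (Finset.range r).erase k, (s i).toNat :=
          Finset.sum_congr rfl fun i hi => by
            rw [hagree i (Finset.mem_range.1 (Finset.mem_of_mem_erase hi))
              (Finset.ne_of_mem_erase hi)]
        rw [heq, htk']
        generalize ∑ i ∈ (Finset.range r).erase k, (s i).toNat = n at hr3
        have hne : s r ≠ t r := hr2
        revert hr3 hne
        generalize s k = p
        generalize s r = q
        generalize t r = q'
        cases p <;> cases q <;> cases q' <;> simp [Nat.even_add, Nat.not_even_iff_odd]

theorem eq_crit_of_tent {lam : Slope} {x : Core lam} (h : coreTent lam x = ptB lam) :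
    x.1 = crit := by
  have h1 := lam.one_lt
  have h := congrArg Subtype.val h
  simp only [coreTent, ptB, rightEnd_eq] at h
  have l := min_le_left (lam.1 * x.1) (lam.1 * (1 - x.1))
  have r := min_le_right (lam.1 * x.1) (lam.1 * (1 - x.1))
  unfold tent at h
  rw [h] at l r
  unfold crit
  nlinarith

theorem eq_ptB_of_tent {lam : Slope} {x : Core lam} (h : coreTent lam x = ptA lam) :
    x = ptB lam := by
  have h1 := lam.one_lt
  have h0 := leftEnd_pos lam
  have e := leftEnd_eq lam
  have h := congrArg Subtype.val h
  simp only [coreTent, ptA] at h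
  unfold tent at h
  apply Subtype.ext
  refine Eq.trans ?_ (rightEnd_eq lam).symm
  rcases min_choice (lam.1 * x.1) (lam.1 * (1 - x.1)) with h2 | h2
  · rw [h2] at h
    nlinarith [x.2.1]
  · rw [h2] at h
    have h := h.trans e
    have := mul_left_cancel₀ (by linarith) h
    show x.1 = lam.1 / 2
    linarith

theorem extreme_up (lam : Slope) (x : Core lam) : IsUpperElement x (extreme lam (up lam x)) := by
  by_cases hb : x = ptB lam
  · subst hb
    rw [← low_ptB]
    refine upper_of_lower (k := 0) (by norm_num) (fun w hw => ?_) (by simp) (extreme_low lam _)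
    exact eq_crit_of_tent ((w.2 0).trans hw)
  by_cases ha : x = ptA lam
  · subst ha
    rw [← low_ptA]
    refine upper_of_lower (k := 1) le_rfl (fun w hw => ?_) ?_ (extreme_low lam _)
    · exact eq_crit_of_tent ((w.2 1).trans (eq_ptB_of_tent ((w.2 0).trans hw)))
    · rintro t ⟨w, hw, ht⟩ i hi
      obtain rfl : i = 0 := by omega
      have hB := eq_ptB_of_tent ((w.2 0).trans hw)
      by_contra hne
      have := (ht 0).1 (by simpa using hne)
      rw [hB] at this
      exact absurd this (not_le.2 (crit_lt_rightEnd lam))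
  unfold extreme
  rw [if_neg (not_onLower_up ha hb), proj_up]
  exact (exists_upper lam x).choose_spec

/-! ## The outside map and the height -/

open Classical in
/-- The outside map `B : S → S`: `B(x_ℓ) = f(x)_ℓ` for `x ∈ [a, c]`, `B(x_ℓ) = f(x)_u` for
`x ∈ [c, b]`, `B(x_u) = f(x)_ℓ` for `x ∈ (â, b]`, and `B = f(a)_ℓ` on `γ = [â_u, a]`. -/
def outsideMap (lam : Slope) (y : Circ) : Circ :=
  if OnLower y then
    if (proj lam y).1 ≤ crit then low lam (coreTent lam (proj lam y))
    else up lam (coreTent lam (proj lam y))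
  else
    if aHat lam < proj lam y then low lam (coreTent lam (proj lam y))
    else low lam (coreTent lam (ptA lam))

/-- The arc `[a, â_u)` of `S`, the domain of the restriction `B̃` of `B`. -/
def outsideDom (lam : Slope) : Set Circ := {y | OnLower y ∨ aHat lam < proj lam y}

/-- The partial map `B̃ : [a, â_u) → S`. -/
def outsidePartial (lam : Slope) : Circ →. Circ := PFun.res (outsideMap lam) (outsideDom lam)

/-- The forward orbit of `y` under a partial map, as long as it is defined. -/
def partialOrbit {X : Type*} (g : X →. X) (y : X) : Set X :=
  {z | Relation.ReflTransGen (fun u v => v ∈ g u) y z}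

/-- The forward orbit of `y` under a map. -/
def orbit {X : Type*} (g : X → X) (y : X) : Set X := {z | ∃ r : ℕ, g^[r] y = z}

/-- The lift of `B` to `ℝ`; see `outsideLift_spec` and `continuous_outsideLift`. -/
def outsideLift (lam : Slope) : CircleDeg1Lift where
  toFun t := coord lam (coreTent lam (ptA lam)) + (⌊t⌋ + min (lam.1 * Int.fract t) 1)
  monotone' := by
    intro s t hst
    have h1 := lam.one_lt
    refine add_le_add le_rfl ?_
    rcases (Int.floor_mono hst).lt_or_eq with h | h
    · have h' : (⌊s⌋ : ℝ) + 1 ≤ ⌊t⌋ := by exact_mod_cast h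
      have hs : min (lam.1 * Int.fract s) 1 ≤ 1 := min_le_right _ _
      have ht : 0 ≤ min (lam.1 * Int.fract t) 1 :=
        le_min (mul_nonneg (by linarith) (Int.fract_nonneg t)) zero_le_one
      linarith
    · have : Int.fract s ≤ Int.fract t := by
        unfold Int.fract; rw [h]; linarith
      have h3 : min (lam.1 * Int.fract s) 1 ≤ min (lam.1 * Int.fract t) 1 :=
        min_le_min (mul_le_mul_of_nonneg_left this (by linarith)) le_rfl
      rw [h]; linarith
  map_add_one' t := by simp; ring

theorem continuous_outsideLift (lam : Slope) : Continuous (outsideLift lam) := by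
  have h1 := lam.one_lt
  have key : Continuous ((fun u : ℝ => min (lam.1 * u) 1 - u) ∘ Int.fract) := by
    refine ContinuousOn.comp_fract'' (Continuous.continuousOn (by fun_prop)) ?_
    simp [min_eq_right h1.le]
  have : (outsideLift lam : ℝ → ℝ) = fun t => coord lam (coreTent lam (ptA lam)) +
      (t + (min (lam.1 * Int.fract t) 1 - Int.fract t)) := by
    funext t
    show coord lam (coreTent lam (ptA lam)) + ((⌊t⌋ : ℝ) + min (lam.1 * Int.fract t) 1) = _
    unfold Int.fract; ring
  rw [this]
  exact continuous_const.add (continuous_id.add key)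

theorem tent_ptA (lam : Slope) : (coreTent lam (ptA lam)).1 = lam.1 * leftEnd lam := by
  have h1 := lam.one_lt
  have hc := leftEnd_lt_crit lam
  unfold crit at hc
  show tent lam (leftEnd lam) = _
  unfold tent
  exact min_eq_left (by nlinarith)

theorem outsideLift_rep (lam : Slope) (y : Circ) :
    ((outsideLift lam (rep y) : ℝ) : UnitAddCircle) = outsideMap lam y := by
  have h1 := lam.one_lt
  have hd := sub_pos.2 (leftEnd_lt_rightEnd lam)
  obtain ⟨r0, r1⟩ := rep_mem y
  have hfl : ⌊rep y⌋ = 0 := Int.floor_eq_zero_iff.2 ⟨r0, r1⟩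
  have hfr : Int.fract (rep y) = rep y := Int.fract_eq_self.2 ⟨r0, r1⟩
  have hval : outsideLift lam (rep y) =
      coord lam (coreTent lam (ptA lam)) + min (lam.1 * rep y) 1 := by
    show _ + ((⌊rep y⌋ : ℝ) + min (lam.1 * Int.fract (rep y)) 1) = _
    rw [hfl, hfr]; simp
  have ea := leftEnd_eq lam
  have eb := rightEnd_eq lam
  have hP : (proj lam y).1 =
    leftEnd lam + 2 * (rightEnd lam - leftEnd lam) * min (rep y) (1 - rep y) := rfl
  have ht : ∀ x : Core lam, (coreTent lam x).1 = min (lam.1 * x.1) (lam.1 * (1 - x.1)) :=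
    fun _ => rfl
  rw [hval]
  unfold outsideMap
  by_cases hl : OnLower y
  · rw [if_pos hl]
    unfold OnLower at hl
    rw [min_eq_left (by linarith)] at hP
    have hsmall : ∀ (_ : 0 ≤ lam.1 * rep y), lam.1 * rep y ≤ 1 := by
      intro _; nlinarith [lam.lt_two]
    rw [min_eq_left (hsmall (by positivity))]
    by_cases hc : (proj lam y).1 ≤ crit
    · rw [if_pos hc]
      unfold crit at hc
      unfold low coord
      rw [tent_ptA, ht, min_eq_left (by nlinarith), hP]
      congr 1
      field_simp
      ring
    · rw [if_neg hc]
      unfold crit at hc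
      unfold up coord
      rw [tent_ptA, ht, min_eq_right (by nlinarith), hP]
      congr 1
      field_simp
      rw [ea, eb]; ring
  · rw [if_neg hl]
    unfold OnLower at hl
    rw [min_eq_right (by linarith)] at hP
    have hb : (1 : ℝ) / 2 ≤ 1 - leftEnd lam := by
      have := leftEnd_lt_crit lam; unfold crit at this; linarith
    have hiff : aHat lam < proj lam y ↔ lam.1 * rep y < 1 := by
      rw [← Subtype.coe_lt_coe, hP]
      show 1 - leftEnd lam < _ ↔ _
      have hkey : lam.1 * (leftEnd lam + 2 * (rightEnd lam - leftEnd lam) * (1 - rep y)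
          - (1 - leftEnd lam)) = 2 * (rightEnd lam - leftEnd lam) * (1 - lam.1 * rep y) := by
        rw [ea, eb]; ring
      constructor
      · intro h
        have : 0 < 2 * (rightEnd lam - leftEnd lam) * (1 - lam.1 * rep y) := by
          rw [← hkey]; exact mul_pos (by linarith) (by linarith)
        have := pos_of_mul_pos_right this (by linarith)
        linarith
      · intro h
        have : 0 < lam.1 * (leftEnd lam + 2 * (rightEnd lam - leftEnd lam) * (1 - rep y)
          - (1 - leftEnd lam)) := by
          rw [hkey]; exact mul_pos (by linarith) (by linarith)
        have := pos_of_mul_pos_right this (by linarith)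
        linarith
    by_cases hc : aHat lam < proj lam y
    · rw [if_pos hc, min_eq_left (hiff.1 hc).le]
      have hgt : 1 / 2 ≤ (proj lam y).1 :=
        hb.trans (le_of_lt (show (aHat lam).1 < (proj lam y).1 from hc))
      have : coord lam (coreTent lam (ptA lam)) + lam.1 * rep y =
          coord lam (coreTent lam (proj lam y)) + 1 := by
        unfold coord
        rw [tent_ptA, ht, min_eq_right (by nlinarith), hP]
        field_simp
        rw [ea, eb]; ring
      rw [this, low]
      rw [AddCircle.coe_add, AddCircle.coe_period, add_zero]
    · rw [if_neg hc, min_eq_right (not_lt.1 fun h => hc (hiff.2 h)), low]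
      rw [AddCircle.coe_add, AddCircle.coe_period, add_zero]

theorem outsideLift_spec (lam : Slope) (t : ℝ) :
    ((outsideLift lam t : ℝ) : UnitAddCircle) = outsideMap lam (t : UnitAddCircle) := by
  rw [← outsideLift_rep]
  have hr : rep (t : UnitAddCircle) = Int.fract t := by
    have h : ((Int.fract t : ℝ) : UnitAddCircle) = (t : UnitAddCircle) := by
      rw [← sub_eq_zero, ← AddCircle.coe_sub, AddCircle.coe_eq_zero_iff]
      exact ⟨-⌊t⌋, by unfold Int.fract; simp⟩
    rw [← h]
    exact rep_coe (Int.fract_nonneg t) (Int.fract_lt_one t)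
  rw [hr]
  conv_lhs => rw [← Int.floor_add_fract t]
  rw [CircleDeg1Lift.map_int_add, AddCircle.coe_add]
  have : (((⌊t⌋ : ℤ) : ℝ) : UnitAddCircle) = 0 := by
    rw [AddCircle.coe_eq_zero_iff]; exact ⟨⌊t⌋, by simp⟩
  rw [this, zero_add]

/-- The height of `f`: the Poincaré rotation number of the outside map `B`. -/
def height (lam : Slope) : ℝ := (outsideLift lam).translationNumber

/-! ## The sets `C_S ⊆ S` and `C ⊆ Î` -/

/-- `C_S`, the closure of the `B̃`-orbit of `f(a)_ℓ`. -/
def cantorS (lam : Slope) : Set Circ :=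
  closure (partialOrbit (outsidePartial lam) (low lam (coreTent lam (ptA lam))))

/-- `C`, the closure of `e(C_S)` in `Î`. -/
def cantorC (lam : Slope) : Set (InvLim lam) := closure (extreme lam '' cantorS lam)

/-- A subset of a metrizable space is a Cantor set: non-empty, compact, perfect, totally
disconnected. -/
def IsCantorSet {X : Type*} [TopologicalSpace X] (K : Set X) : Prop :=
  K.Nonempty ∧ IsCompact K ∧ Perfect K ∧ IsTotallyDisconnected K

end TentMap

end

noncomputable section

namespace TentMap

open Set Filter Topology MeasureTheory

/-! In the coordinate `rep`, the outside map is `t ↦ 1 - λ/2 + min (λt) 1` modulo 1. It maps `[0,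
1/λ)` bijectively onto the circle with slope `λ`, and collapses the plateau `[1/λ, 1]` to the single
point `p = plateauImage`. Irrational height excludes periodic points (`iterate_ne_self`), so the
orbit of `p` never meets the closed plateau, and `C_S` is the closure of an infinite forward orbit.

The exact shape of `C_S` at the plateau comes from a measure count. The complementary gap `(u, v)`
of `C_S` around the open plateau is wandering, so its iterated preimages are pairwise disjoint and
miss `C_S`; each preimage shrinks length by `1/λ`. Hence `(v - u) / (1 - 1/λ) + |C_S| ≤ 1`, while `v
- u ≥ 1 - 1/λ`. Equality is forced: both ends of the plateau, `â_u` and `a`, lie in `C_S`, and `C_S`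
is null (`plateau_endpoints_mem`).

The extreme elements are explicit: `e(y)` is the projection to `I` of the backward orbit of `y`
under the inverse branch `outsideInv` (`extreme_eq`). The side of the circle on which this orbit
lies records the parity of the ones read so far, which is what the unimodal order compares.

The set `C` is then the set `projectedOrbits` of projections of all backward orbits of `B` inside
`C_S`. Such an orbit leaves the branch `outsideInv` only at `â_u`, and at most once since nothing is
periodic; this gives the stated decomposition (`projectedOrbits_eq`). Density follows by
approximating a late term of the backward orbit by the orbit of `p` and applying `B`. There is no
isolated point, because otherwise `e(a)` would lie on the forward orbit of its own image. Total
disconnectedness holds because every coordinate of `C` takes values in the null set `τ(C_S)`. -/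

theorem Slope.pos (lam : Slope) : 0 < lam.1 := by linarith [lam.one_lt]

/-! ### The outside map in the coordinate of `ℝ/ℤ` -/

theorem coord_tent_ptA (lam : Slope) : coord lam (coreTent lam (ptA lam)) = 1 - lam.1 / 2 := by
  have h1 := lam.one_lt
  have h2 : lam.1 - 1 ≠ 0 := by linarith
  unfold coord
  rw [tent_ptA, leftEnd_eq, rightEnd_eq, div_eq_iff (by nlinarith)]
  ring

theorem outsideMap_eq_coe (lam : Slope) (y : Circ) :
    outsideMap lam y = ((1 - lam.1 / 2 + min (lam.1 * rep y) 1 : ℝ) : UnitAddCircle) := by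
  rw [← outsideLift_rep]
  obtain ⟨r0, r1⟩ := rep_mem y
  congr 1
  show _ + ((⌊rep y⌋ : ℝ) + min (lam.1 * Int.fract (rep y)) 1) = _
  rw [Int.floor_eq_zero_iff.2 ⟨r0, r1⟩, Int.fract_eq_self.2 ⟨r0, r1⟩, coord_tent_ptA]
  simp

/-- The image of the plateau of the outside map. -/
def plateauImage (lam : Slope) : Circ := low lam (coreTent lam (ptA lam))

theorem plateauImage_eq_coe (lam : Slope) :
    plateauImage lam = ((1 - lam.1 / 2 : ℝ) : UnitAddCircle) := by
  rw [plateauImage, low, coord_tent_ptA]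

theorem outsideMap_of_one_le {lam : Slope} {y : Circ} (h : 1 ≤ lam.1 * rep y) :
    outsideMap lam y = plateauImage lam := by
  rw [outsideMap_eq_coe, min_eq_right h, plateauImage_eq_coe, AddCircle.coe_add,
    AddCircle.coe_period, add_zero]

theorem outsideMap_zero (lam : Slope) : outsideMap lam 0 = plateauImage lam := by
  have h : rep (0 : Circ) = 0 := by
    simpa using rep_coe (le_refl (0 : ℝ)) zero_lt_one
  rw [outsideMap_eq_coe, h, plateauImage_eq_coe]
  simp

theorem continuous_outsideMap (lam : Slope) : Continuous (outsideMap lam) := by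
  have h : Continuous fun t : ℝ => outsideMap lam (t : UnitAddCircle) := by
    simp_rw [← outsideLift_spec]
    exact (AddCircle.continuous_mk' 1).comp (continuous_outsideLift lam)
  exact isQuotientMap_quotient_mk'.continuous_iff.2 h

/-- The quantity `min t (1 - t)` is the distance to `0` in `ℝ/ℤ`. This form gives continuity of
`proj`, although `rep` jumps at `0`. -/
theorem proj_eq_norm (lam : Slope) (y : Circ) :
    (proj lam y).1 = leftEnd lam + 2 * (rightEnd lam - leftEnd lam) * ‖y‖ := by
  obtain ⟨r0, r1⟩ := rep_mem y
  conv_rhs => rw [← coe_rep y]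
  rw [UnitAddCircle.norm_eq, abs_sub_round_eq_min, Int.fract_eq_self.2 ⟨r0, r1⟩]
  rfl

theorem continuous_proj (lam : Slope) : Continuous (proj lam) := by
  refine Continuous.subtype_mk (f := fun y => (proj lam y).1) ?_ _
  simp_rw [proj_eq_norm]
  fun_prop

theorem eq_zero_of_proj_eq_ptA {lam : Slope} {y : Circ} (h : proj lam y = ptA lam) : y = 0 := by
  have h1 := proj_eq_norm lam y
  rw [h] at h1
  have h2 := sub_pos.2 (leftEnd_lt_rightEnd lam)
  have h3 : 2 * (rightEnd lam - leftEnd lam) * ‖y‖ = 0 := by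
    simp only [ptA] at h1; linarith
  exact norm_eq_zero.1 ((mul_eq_zero.1 h3).resolve_left (by linarith))

theorem proj_zero (lam : Slope) : proj lam 0 = ptA lam := by
  apply Subtype.ext
  rw [proj_eq_norm, norm_zero, mul_zero, add_zero]
  rfl

theorem coord_aHat (lam : Slope) : 1 - coord lam (aHat lam) = 1 / lam.1 := by
  have h1 := lam.one_lt
  have h2 : 2 * (lam.1 / 2 - lam.1 * (1 - lam.1 / 2)) ≠ 0 := by nlinarith
  have h3 := lam.pos.ne'
  have h4 := sub_pos.2 (leftEnd_lt_rightEnd lam)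
  rw [coord, sub_eq_iff_eq_add, ← sub_eq_iff_eq_add', eq_div_iff (by linarith)]
  simp only [aHat, leftEnd_eq, rightEnd_eq]
  field_simp
  ring

theorem up_aHat (lam : Slope) : up lam (aHat lam) = ((1 / lam.1 : ℝ) : UnitAddCircle) := by
  rw [up, coord_aHat]

theorem one_div_slope_lt (lam : Slope) : 1 / lam.1 < 1 := by
  rw [div_lt_one lam.pos]; exact lam.one_lt

theorem rep_up_aHat (lam : Slope) : rep (up lam (aHat lam)) = 1 / lam.1 := by
  rw [up_aHat]
  exact rep_coe (by have := lam.pos; positivity) (one_div_slope_lt lam)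

theorem outsideMap_up_aHat (lam : Slope) : outsideMap lam (up lam (aHat lam)) = plateauImage lam :=
  outsideMap_of_one_le (by rw [rep_up_aHat, mul_one_div_cancel lam.pos.ne'])

theorem eq_up_aHat {lam : Slope} {y : Circ} (h : lam.1 * rep y = 1) : y = up lam (aHat lam) := by
  have h1 : rep y = 1 / lam.1 := eq_div_of_mul_eq lam.pos.ne' (by rw [mul_comm, h])
  rw [up_aHat, ← coe_rep y, h1]

theorem aHat_lt_proj_iff {lam : Slope} {y : Circ} (h : ¬ OnLower y) :
    aHat lam < proj lam y ↔ lam.1 * rep y < 1 := by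
  have h2 := sub_pos.2 (leftEnd_lt_rightEnd lam)
  have h3 := coord_spec lam (aHat lam)
  have h4 := coord_aHat lam
  have h5 : (proj lam y).1 =
    leftEnd lam + 2 * (rightEnd lam - leftEnd lam) * min (rep y) (1 - rep y) := rfl
  unfold OnLower at h
  rw [min_eq_right (by linarith)] at h5
  rw [← Subtype.coe_lt_coe, h5, ← h3, add_lt_add_iff_left, mul_lt_mul_iff_right₀ (by linarith),
    mul_comm, ← lt_div_iff₀ lam.pos, ← h4]
  constructor <;> intro h <;> linarith

theorem mem_outsideDom_iff {lam : Slope} {y : Circ} :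
    y ∈ outsideDom lam ↔ lam.1 * rep y < 1 := by
  by_cases h : OnLower y
  · refine iff_of_true (Or.inl h) ?_
    unfold OnLower at h
    nlinarith [lam.lt_two, (rep_mem y).1, lam.pos]
  · rw [← aHat_lt_proj_iff h]
    exact or_iff_right h

/-- The projection semiconjugates the outside map to the core tent map off the interior of the
plateau. -/
theorem coreTent_proj {lam : Slope} {y : Circ} (h : lam.1 * rep y ≤ 1) :
    coreTent lam (proj lam y) = proj lam (outsideMap lam y) := by
  unfold outsideMap
  split_ifs with h1 h2 h3
  · rw [proj_low]
  · rw [proj_up]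
  · rw [proj_low]
  -- Only the closed end `â_u` of the plateau remains, and there `f(â) = f(a)`.
  · have h4 : lam.1 * rep y = 1 :=
      le_antisymm h (not_lt.1 fun h5 => h3 ((aHat_lt_proj_iff h1).2 h5))
    rw [proj_low, eq_up_aHat h4, proj_up]
    exact ((aHat_spec lam _).2 rfl).2

/-! ### The inverse branch onto the complement of the plateau -/

theorem outsideMap_injOn (lam : Slope) : InjOn (outsideMap lam) (outsideDom lam) := by
  intro y hy z hz h
  rw [mem_outsideDom_iff] at hy hz
  rw [outsideMap_eq_coe, outsideMap_eq_coe, min_eq_left hy.le, min_eq_left hz.le, ← sub_eq_zero,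
    ← AddCircle.coe_sub, AddCircle.coe_eq_zero_iff] at h
  obtain ⟨n, hn⟩ := h
  have hl := lam.pos
  have hy0 := mul_nonneg hl.le (rep_mem y).1
  have hz0 := mul_nonneg hl.le (rep_mem z).1
  simp only [zsmul_eq_mul, mul_one] at hn
  have hn1 : (n : ℝ) < 1 := by linarith
  have hn2 : (-1 : ℝ) < n := by linarith
  have hn0 : n = 0 := by
    have : n < 1 := by exact_mod_cast hn1
    have : -1 < n := by exact_mod_cast hn2
    omega
  rw [hn0, Int.cast_zero] at hn
  rw [← coe_rep y, ← coe_rep z, mul_left_cancel₀ hl.ne' (by linarith : lam.1 * rep y = lam.1 * rep z)]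

/-- The inverse of the restriction of the outside map to `outsideDom`. -/
def outsideInv (lam : Slope) (y : Circ) : Circ :=
  (((if rep y < 1 - lam.1 / 2 then rep y + lam.1 / 2 else rep y - (1 - lam.1 / 2)) / lam.1 : ℝ) :
    UnitAddCircle)

theorem rep_outsideInv (lam : Slope) (y : Circ) : rep (outsideInv lam y) =
    (if rep y < 1 - lam.1 / 2 then rep y + lam.1 / 2 else rep y - (1 - lam.1 / 2)) / lam.1 := by
  have h1 := lam.one_lt
  have h2 := lam.lt_two
  obtain ⟨r0, r1⟩ := rep_mem y
  refine rep_coe (div_nonneg ?_ lam.pos.le) ((div_lt_one lam.pos).2 ?_) <;> split_ifs <;> linarith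

theorem outsideInv_mem (lam : Slope) (y : Circ) : outsideInv lam y ∈ outsideDom lam := by
  have h2 := lam.lt_two
  obtain ⟨r0, r1⟩ := rep_mem y
  rw [mem_outsideDom_iff, rep_outsideInv, mul_div_cancel₀ _ lam.pos.ne']
  have := lam.pos
  split_ifs <;> linarith

theorem outsideMap_outsideInv (lam : Slope) (y : Circ) :
    outsideMap lam (outsideInv lam y) = y := by
  have h := mem_outsideDom_iff.1 (outsideInv_mem lam y)
  rw [outsideMap_eq_coe, min_eq_left h.le, rep_outsideInv, mul_div_cancel₀ _ lam.pos.ne']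
  conv_rhs => rw [← coe_rep y]
  split_ifs
  · rw [show 1 - lam.1 / 2 + (rep y + lam.1 / 2) = rep y + 1 by ring, AddCircle.coe_add,
      AddCircle.coe_period, add_zero]
  · rw [add_sub_cancel]

theorem outsideInv_outsideMap {lam : Slope} {y : Circ} (h : y ∈ outsideDom lam) :
    outsideInv lam (outsideMap lam y) = y :=
  outsideMap_injOn lam (outsideInv_mem lam _) h (outsideMap_outsideInv lam _)

/-! ### Irrational height and the orbit of the plateau image -/

theorem outsideMap_iterate_coe (lam : Slope) (n : ℕ) (t : ℝ) :
    (outsideMap lam)^[n] (t : UnitAddCircle) = (((outsideLift lam ^ n) t : ℝ) : UnitAddCircle) := by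
  induction n with
  | zero => rfl
  | succ n ih =>
    rw [Function.iterate_succ_apply', ih, ← outsideLift_spec, pow_succ', CircleDeg1Lift.mul_apply]

theorem not_irrational_height {lam : Slope} {n : ℕ} {t : ℝ} {m : ℤ} (hn : 0 < n)
    (h : (outsideLift lam ^ n) t = t + m) : ¬ Irrational (height lam) := by
  rw [height, CircleDeg1Lift.translationNumber_of_map_pow_eq_add_int _ h hn]
  intro h'
  exact h' ⟨(m : ℚ) / n, by push_cast; rfl⟩

/-- A periodic point of the circle lifts to a solution of `F^n(t) = t + m`, which makes the
translation number `m / n`. -/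
theorem iterate_ne_self {lam : Slope} (hq : Irrational (height lam)) {n : ℕ} (hn : 0 < n)
    (y : Circ) : (outsideMap lam)^[n] y ≠ y := by
  intro h
  rw [← coe_rep y, outsideMap_iterate_coe, ← sub_eq_zero, ← AddCircle.coe_sub,
    AddCircle.coe_eq_zero_iff] at h
  obtain ⟨m, hm⟩ := h
  exact not_irrational_height (m := m) hn (eq_add_of_sub_eq' (hm.symm.trans (by simp))) hq

/-- The forward orbit of the image of the plateau. -/
def plateauOrbit (lam : Slope) : Set Circ := orbit (outsideMap lam) (plateauImage lam)

theorem mapsTo_plateauOrbit (lam : Slope) :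
    MapsTo (outsideMap lam) (plateauOrbit lam) (plateauOrbit lam) := by
  rintro _ ⟨n, rfl⟩
  exact ⟨n + 1, Function.iterate_succ_apply' _ _ _⟩

theorem outsideMap_ne_plateauImage {lam : Slope} (hq : Irrational (height lam)) {y : Circ}
    (hy : y ∈ plateauOrbit lam) : outsideMap lam y ≠ plateauImage lam := by
  obtain ⟨n, rfl⟩ := hy
  rw [← Function.iterate_succ_apply' (outsideMap lam)]
  exact iterate_ne_self hq n.succ_pos _

/-- A visit to the closed plateau would send the orbit back to its starting point `p`. -/
theorem plateauOrbit_lt {lam : Slope} (hq : Irrational (height lam)) {y : Circ}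
    (hy : y ∈ plateauOrbit lam) : lam.1 * rep y < 1 :=
  not_le.1 fun h => outsideMap_ne_plateauImage hq hy (outsideMap_of_one_le h)

/-- The partial orbit never stops, because it never leaves the domain of `B̃`. From here on only the
total map matters. -/
theorem partialOrbit_eq {lam : Slope} (hq : Irrational (height lam)) :
    partialOrbit (outsidePartial lam) (low lam (coreTent lam (ptA lam))) = plateauOrbit lam := by
  ext z
  constructor
  · intro h
    induction h with
    | refl => exact ⟨0, rfl⟩
    | tail _ h ih =>
      obtain ⟨-, rfl⟩ := PFun.mem_res _ _ _ _ |>.1 h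
      exact mapsTo_plateauOrbit lam ih
  · rintro ⟨n, rfl⟩
    induction n with
    | zero => exact Relation.ReflTransGen.refl
    | succ n ih =>
      refine Relation.ReflTransGen.tail ih (PFun.mem_res _ _ _ _ |>.2 ⟨?_, ?_⟩)
      · exact mem_outsideDom_iff.2 (plateauOrbit_lt hq ⟨n, rfl⟩)
      · exact (Function.iterate_succ_apply' _ _ _).symm

theorem cantorS_eq {lam : Slope} (hq : Irrational (height lam)) :
    cantorS lam = closure (plateauOrbit lam) := by
  rw [cantorS, partialOrbit_eq hq]

theorem isClosed_cantorS (lam : Slope) : IsClosed (cantorS lam) := isClosed_closure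

theorem plateauOrbit_subset {lam : Slope} (hq : Irrational (height lam)) :
    plateauOrbit lam ⊆ cantorS lam := by
  rw [cantorS_eq hq]; exact subset_closure

theorem plateauImage_mem_cantorS {lam : Slope} (hq : Irrational (height lam)) :
    plateauImage lam ∈ cantorS lam := plateauOrbit_subset hq ⟨0, rfl⟩

theorem mapsTo_cantorS {lam : Slope} (hq : Irrational (height lam)) :
    MapsTo (outsideMap lam) (cantorS lam) (cantorS lam) := by
  rw [cantorS_eq hq]
  exact (mapsTo_plateauOrbit lam).closure (continuous_outsideMap lam)

theorem mapsTo_iterate_cantorS {lam : Slope} (hq : Irrational (height lam)) {t : ℝ}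
    (ht : (t : Circ) ∈ cantorS lam) (n : ℕ) :
    (((outsideLift lam ^ n) t : ℝ) : Circ) ∈ cantorS lam := by
  rw [← outsideMap_iterate_coe]
  exact (mapsTo_cantorS hq).iterate n ht

/-- The plateau has no orbit points in its interior. -/
theorem coe_notMem_cantorS {lam : Slope} (hq : Irrational (height lam)) {t : ℝ}
    (h0 : 1 / lam.1 < t) (h1 : t < 1) : (t : Circ) ∉ cantorS lam := by
  rw [cantorS_eq hq]
  intro h
  have ho : IsOpen (((↑) : ℝ → Circ) '' Ioo (1 / lam.1) 1) :=
    QuotientAddGroup.isOpenMap_coe _ isOpen_Ioo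
  obtain ⟨_, ⟨s, hs, rfl⟩, hs'⟩ := mem_closure_iff.1 h _ ho ⟨t, ⟨h0, h1⟩, rfl⟩
  have hp : 0 < 1 / lam.1 := one_div_pos.2 lam.pos
  have := plateauOrbit_lt hq hs'
  rw [rep_coe (hp.trans hs.1).le hs.2] at this
  have := (div_lt_iff₀' lam.pos).1 hs.1
  linarith

theorem cantorS_le {lam : Slope} (hq : Irrational (height lam)) {y : Circ}
    (hy : y ∈ cantorS lam) : lam.1 * rep y ≤ 1 := by
  by_contra h
  rw [← coe_rep y] at hy
  exact coe_notMem_cantorS hq ((div_lt_iff₀' lam.pos).2 (not_le.1 h)) (rep_mem y).2 hy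

/-! ### The gap around the plateau: wandering and measure -/

/-- The first return of a complementary gap to itself would produce a periodic point. -/
theorem gap_wandering {lam : Slope} (hq : Irrational (height lam)) {u v x : ℝ}
    (hu : (u : Circ) ∈ cantorS lam) (hv : (v : Circ) ∈ cantorS lam)
    (hgap : ∀ t ∈ Ioo u v, (t : Circ) ∉ cantorS lam) (hx : x ∈ Ioo u v) {n : ℕ} (hn : 0 < n)
    (m : ℤ) : (outsideLift lam ^ n) x + m ∉ Ioo u v := by
  intro hGx
  have hG : ∀ t : ℝ, (t : Circ) ∈ cantorS lam →
      (((outsideLift lam ^ n) t + m : ℝ) : Circ) ∈ cantorS lam := fun t ht => by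
    have h : ((m : ℝ) : Circ) = 0 := by rw [AddCircle.coe_eq_zero_iff]; exact ⟨m, by simp⟩
    rw [AddCircle.coe_add, h, add_zero]
    exact mapsTo_iterate_cantorS hq ht n
  have hmono := (outsideLift lam ^ n).monotone
  -- Write `G = F^n + m`. By monotonicity `G u ≤ G x < v`, and `G u` projects into `C_S`, so it
  -- cannot lie inside the gap. The same holds at `v`, so `G` stretches `[u, v]` over itself and has
  -- a fixed point there.
  have hGu : (outsideLift lam ^ n) u + m ≤ u := by
    by_contra! h
    exact hgap _ ⟨h, by linarith [hmono hx.1.le, hGx.2]⟩ (hG u hu)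
  have hGv : v ≤ (outsideLift lam ^ n) v + m := by
    by_contra! h
    exact hgap _ ⟨by linarith [hmono hx.2.le, hGx.1], h⟩ (hG v hv)
  have hc : Continuous fun t => (outsideLift lam ^ n) t + m - t := by
    have : Continuous (outsideLift lam ^ n) := by
      rw [CircleDeg1Lift.coe_pow]; exact (continuous_outsideLift lam).iterate n
    fun_prop
  obtain ⟨t, -, ht⟩ := intermediate_value_Icc (hx.1.trans hx.2).le hc.continuousOn
    (show (0 : ℝ) ∈ _ from ⟨by linarith, by linarith⟩)
  exact not_irrational_height (m := -m) hn
    (by push_cast; simp only at ht; linarith : (outsideLift lam ^ n) t = t + ((-m : ℤ) : ℝ)) hq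

theorem volume_eq_Ioc (X : Set Circ) (hX : MeasurableSet X) (a : ℝ) :
    volume X = volume (((↑) : ℝ → Circ) ⁻¹' X ∩ Ioc a (a + 1)) := by
  have h := (UnitAddCircle.measurePreserving_mk a).measure_preimage hX.nullMeasurableSet
  rw [← h, Measure.restrict_apply (measurableSet_preimage AddCircle.measurable_mk' hX)]

/-- Pulling back by the outside map scales the measure of sets that do not contain the image of
the plateau. -/
theorem volume_preimage_outsideMap {lam : Slope} {X : Set Circ} (hX : MeasurableSet X)
    (hp : plateauImage lam ∉ X) :
    volume (outsideMap lam ⁻¹' X) = ENNReal.ofReal lam.1⁻¹ * volume X := by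
  have hl := lam.pos
  rw [volume_eq_Ioc _ ((continuous_outsideMap lam).measurable hX) 0,
    volume_eq_Ioc X hX (1 - lam.1 / 2)]
  have hrep : ∀ t : ℝ, 0 < t → t < 1 → outsideMap lam (t : Circ) =
      ((1 - lam.1 / 2 + min (lam.1 * t) 1 : ℝ) : UnitAddCircle) := fun t h0 h1 => by
    rw [outsideMap_eq_coe, rep_coe h0.le h1]
  -- Reading the target on the window that starts at `1 - λ/2`, a lift of `p`, makes the branch `t ↦
  -- (1 - λ/2) + λt` affine with no wrapping. The plateau contributes nothing because `p ∉ X`.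
  have h1 : ((↑) : ℝ → Circ) ⁻¹' (outsideMap lam ⁻¹' X) ∩ Ioc 0 (0 + 1) =
      (fun t => lam.1 * t) ⁻¹' ((fun t => (1 - lam.1 / 2) + t) ⁻¹'
        (((↑) : ℝ → Circ) ⁻¹' X ∩ Ioc (1 - lam.1 / 2) (1 - lam.1 / 2 + 1))) := by
    ext t
    simp only [mem_inter_iff, mem_preimage, mem_Ioc, zero_add]
    constructor
    · rintro ⟨hX, h0, h1⟩
      have hlt : lam.1 * t < 1 := by
        by_contra! hge
        refine hp ?_
        rcases h1.lt_or_eq with h1 | rfl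
        · rw [← outsideMap_of_one_le (y := (t : Circ)) (by rwa [rep_coe h0.le h1])]
          exact hX
        -- The endpoint `t = 1` has `rep` equal to `0`, so the plateau formula in terms of `rep`
        -- does not cover it.
        · rw [AddCircle.coe_period, outsideMap_zero] at hX
          exact hX
      have h1 : t < 1 := by nlinarith [lam.one_lt]
      rw [hrep t h0 h1, min_eq_left hlt.le] at hX
      exact ⟨hX, by nlinarith, by linarith⟩
    · rintro ⟨hX, h0, h1⟩
      have h0 : 0 < lam.1 * t := by linarith
      have h0 : 0 < t := pos_of_mul_pos_right h0 hl.le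
      have h1 : lam.1 * t ≤ 1 := by linarith
      have h1' : t < 1 := by nlinarith [lam.one_lt]
      rw [hrep t h0 h1', min_eq_left h1]
      exact ⟨hX, h0, h1'.le⟩
  rw [h1, Real.volume_preimage_mul_left hl.ne', measure_preimage_add,
    abs_of_pos (inv_pos.2 hl)]

/-- If `X` misses the whole orbit of `p`, then no preimage of `X` contains `p`, so the scaling
factor applies at every step. -/
theorem volume_preimage_iterate {lam : Slope} {X : Set Circ} (hX : MeasurableSet X)
    (hp : ∀ y ∈ plateauOrbit lam, y ∉ X) (n : ℕ) :
    volume ((outsideMap lam)^[n] ⁻¹' X) = ENNReal.ofReal lam.1⁻¹ ^ n * volume X := by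
  induction n with
  | zero => simp
  | succ n ih =>
    rw [Function.iterate_succ, preimage_comp, volume_preimage_outsideMap, ih, pow_succ']
    · ring
    · exact ((continuous_outsideMap lam).iterate n).measurable hX
    · exact hp _ ⟨n, rfl⟩

/-- The complementary gap of `cantorS` around the plateau. -/
theorem exists_gap {lam : Slope} (hq : Irrational (height lam)) :
    ∃ u v : ℝ, u ≤ 1 / lam.1 ∧ 1 ≤ v ∧ v ≤ u + 1 ∧ (u : Circ) ∈ cantorS lam ∧
      (v : Circ) ∈ cantorS lam ∧ ∀ t ∈ Ioo u v, (t : Circ) ∉ cantorS lam := by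
  set K : Set ℝ := ((↑) : ℝ → Circ) ⁻¹' cantorS lam
  have hK : IsClosed K := (isClosed_cantorS lam).preimage (AddCircle.continuous_mk' 1)
  have hl := lam.pos
  have h1 := lam.one_lt
  have h2 := lam.lt_two
  have hp : 1 - lam.1 / 2 ∈ K := by
    show ((1 - lam.1 / 2 : ℝ) : Circ) ∈ cantorS lam
    rw [← plateauImage_eq_coe]; exact plateauImage_mem_cantorS hq
  have hadd : ∀ t ∈ K, t + 1 ∈ K := fun t ht => by
    show ((t + 1 : ℝ) : Circ) ∈ cantorS lam
    rwa [AddCircle.coe_add, AddCircle.coe_period, add_zero]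
  have hmid : ∀ t ∈ K, 1 / lam.1 < t → 1 ≤ t := fun t ht h =>
    not_lt.1 fun h' => coe_notMem_cantorS hq h h' ht
  have hpl : 1 - lam.1 / 2 ≤ 1 / lam.1 := by rw [le_div_iff₀ hl]; nlinarith
  have bu : BddAbove (K ∩ Iic (1 / lam.1)) := bddAbove_Iic.mono inter_subset_right
  have bv : BddBelow (K ∩ Ici 1) := bddBelow_Ici.mono inter_subset_right
  have hu := (hK.inter isClosed_Iic).csSup_mem ⟨_, hp, hpl⟩ bu
  have hv := (hK.inter isClosed_Ici).csInf_mem ⟨_, hadd _ hp, show (1 : ℝ) ≤ _ by linarith⟩ bv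
  set u := sSup (K ∩ Iic (1 / lam.1))
  set v := sInf (K ∩ Ici 1)
  -- The point `u + 1` is in the periodic set `K` and exceeds `1/λ` by maximality of `u`, hence is
  -- at least `1`. So it competes in the infimum defining `v`.
  refine ⟨u, v, hu.2, hv.2, csInf_le bv ⟨hadd u hu.1, hmid _ (hadd u hu.1) ?_⟩, hu.1, hv.1, ?_⟩
  · by_contra! h
    linarith [le_csSup bu ⟨hadd u hu.1, h⟩]
  · intro t ht htK
    rcases le_or_gt t (1 / lam.1) with h | h
    · exact (le_csSup bu ⟨htK, h⟩).not_gt ht.1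
    · exact (csInf_le bv ⟨htK, hmid t htK h⟩).not_gt ht.2

/-- The preimages of a wandering gap are pairwise disjoint. They also miss `C_S`, which is forward
invariant and disjoint from the gap. Their measures sum as a geometric series of ratio `1/λ` inside
a circle of measure one. -/
theorem gap_sum_le {lam : Slope} (hq : Irrational (height lam)) {u v : ℝ}
    (huv : v ≤ u + 1) (hu : (u : Circ) ∈ cantorS lam) (hv : (v : Circ) ∈ cantorS lam)
    (hgap : ∀ t ∈ Ioo u v, (t : Circ) ∉ cantorS lam) :
    ENNReal.ofReal ((1 - lam.1⁻¹)⁻¹ * (v - u)) + volume (cantorS lam) ≤ 1 := by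
  set J : Set Circ := ((↑) : ℝ → Circ) '' Ioo u v
  have hJo : IsOpen J := QuotientAddGroup.isOpenMap_coe _ isOpen_Ioo
  have hJ : MeasurableSet J := hJo.measurableSet
  have hJK : ∀ y ∈ J, y ∉ cantorS lam := by
    rintro _ ⟨t, ht, rfl⟩
    exact hgap t ht
  have hw : ∀ y ∈ J, ∀ n, 0 < n → (outsideMap lam)^[n] y ∉ J := by
    rintro _ ⟨x, hx, rfl⟩ n hn ⟨t, ht, h⟩
    rw [outsideMap_iterate_coe, ← sub_eq_zero, ← AddCircle.coe_sub,
      AddCircle.coe_eq_zero_iff] at h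
    obtain ⟨m, hm⟩ := h
    simp only [zsmul_eq_mul, mul_one] at hm
    refine gap_wandering hq hu hv hgap hx hn m ?_
    rwa [hm, add_sub_cancel]
  have hmeas : ∀ n, MeasurableSet ((outsideMap lam)^[n] ⁻¹' J) := fun n =>
    ((continuous_outsideMap lam).iterate n).measurable hJ
  have hdisj : Pairwise (Function.onFun Disjoint fun n => (outsideMap lam)^[n] ⁻¹' J) := by
    refine (pairwise_disjoint_on _).2 fun m n hmn => ?_
    rw [Set.disjoint_left]
    intro y hm hn
    refine hw _ hm (n - m) (by omega) ?_
    rw [← Function.iterate_add_apply, Nat.sub_add_cancel hmn.le]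
    exact hn
  have hinv0 : 0 ≤ lam.1⁻¹ := (inv_pos.2 lam.pos).le
  have hinv1 : 0 < 1 - lam.1⁻¹ := sub_pos.2 (inv_lt_one_of_one_lt₀ lam.one_lt)
  have hsum : volume (⋃ n, (outsideMap lam)^[n] ⁻¹' J) =
      ENNReal.ofReal (1 - lam.1⁻¹)⁻¹ * volume J := by
    rw [measure_iUnion hdisj hmeas]
    simp_rw [volume_preimage_iterate hJ fun y hy hyJ => hJK y hyJ (plateauOrbit_subset hq hy)]
    rw [ENNReal.tsum_mul_right, ENNReal.tsum_geometric, ENNReal.ofReal_inv_of_pos hinv1,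
      ENNReal.ofReal_sub _ hinv0, ENNReal.ofReal_one]
  have hJvol : ENNReal.ofReal (v - u) ≤ volume J := by
    rw [volume_eq_Ioc J hJ u, ← Real.volume_Ioo]
    -- The bound `v ≤ u + 1` keeps the gap within one fundamental domain, so no length is lost in
    -- the quotient.
    exact measure_mono fun t ht => ⟨⟨t, ht, rfl⟩, ht.1, ht.2.le.trans huv⟩
  have hd : Disjoint (⋃ n, (outsideMap lam)^[n] ⁻¹' J) (cantorS lam) := by
    rw [Set.disjoint_left]
    intro y hy hyK
    obtain ⟨n, hn⟩ := mem_iUnion.1 hy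
    exact hJK _ hn ((mapsTo_cantorS hq).iterate n hyK)
  calc ENNReal.ofReal ((1 - lam.1⁻¹)⁻¹ * (v - u)) + volume (cantorS lam)
      ≤ volume (⋃ n, (outsideMap lam)^[n] ⁻¹' J) + volume (cantorS lam) := by
        rw [ENNReal.ofReal_mul (inv_pos.2 hinv1).le, hsum]
        gcongr
    _ = volume ((⋃ n, (outsideMap lam)^[n] ⁻¹' J) ∪ cantorS lam) :=
        (measure_union hd (isClosed_cantorS lam).measurableSet).symm
    _ ≤ volume (univ : Set Circ) := measure_mono (subset_univ _)
    _ = 1 := by rw [AddCircle.measure_univ, ENNReal.ofReal_one]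

/-- The gap contains the open plateau, whose preimages already account for full measure. The bound
of `gap_sum_le` is therefore an equality: the gap is exactly the open plateau, and nothing is left
for `C_S`. -/
theorem plateau_endpoints_mem {lam : Slope} (hq : Irrational (height lam)) :
    up lam (aHat lam) ∈ cantorS lam ∧ (0 : Circ) ∈ cantorS lam ∧ volume (cantorS lam) = 0 := by
  obtain ⟨u, v, hu1, hv1, huv, hu, hv, hgap⟩ := exists_gap hq
  have hsum := gap_sum_le hq huv hu hv hgap
  have hinv1 : 0 < 1 - lam.1⁻¹ := sub_pos.2 (inv_lt_one_of_one_lt₀ lam.one_lt)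
  rw [one_div] at hu1
  have hge : 1 ≤ (1 - lam.1⁻¹)⁻¹ * (v - u) := by
    rw [← div_eq_inv_mul, le_div_iff₀ hinv1]; linarith
  have hle : (1 - lam.1⁻¹)⁻¹ * (v - u) ≤ 1 := by
    rw [← ENNReal.ofReal_le_one]; exact le_self_add.trans hsum
  have hvol : volume (cantorS lam) = 0 := by
    have h1 : ENNReal.ofReal ((1 - lam.1⁻¹)⁻¹ * (v - u)) = 1 := by
      rw [le_antisymm hle hge, ENNReal.ofReal_one]
    rw [h1] at hsum
    have h2 : 1 + volume (cantorS lam) ≤ 1 + 0 := by simpa using hsum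
    exact le_antisymm ((ENNReal.add_le_add_iff_left ENNReal.one_ne_top).1 h2) zero_le
  rw [← div_eq_inv_mul, div_le_iff₀ hinv1] at hle
  have hu' : u = 1 / lam.1 := by rw [one_div]; linarith
  have hv' : v = 1 := by linarith
  subst hu' hv'
  refine ⟨by rwa [up_aHat], ?_, hvol⟩
  rwa [AddCircle.coe_period] at hv

/-! ### Backward invariance of `C_S` -/

theorem outsideInv_plateauImage (lam : Slope) : outsideInv lam (plateauImage lam) = 0 := by
  rw [← outsideMap_zero, outsideInv_outsideMap]
  rw [mem_outsideDom_iff]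
  have h : rep (0 : Circ) = 0 := by simpa using rep_coe (le_refl (0 : ℝ)) zero_lt_one
  rw [h]; norm_num

theorem cantorS_subset {lam : Slope} (hq : Irrational (height lam)) :
    cantorS lam ⊆ insert (plateauImage lam) (outsideMap lam '' cantorS lam) := by
  have hK : IsCompact (cantorS lam) := (isClosed_cantorS lam).isCompact
  have hc : IsClosed (insert (plateauImage lam) (outsideMap lam '' cantorS lam)) :=
    ((hK.image (continuous_outsideMap lam)).insert _).isClosed
  conv_lhs => rw [cantorS_eq hq]
  refine closure_minimal ?_ hc
  rintro _ ⟨_ | n, rfl⟩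
  · exact mem_insert _ _
  · refine mem_insert_of_mem _ ⟨_, plateauOrbit_subset hq ⟨n, rfl⟩, ?_⟩
    exact (Function.iterate_succ_apply' _ _ _).symm

theorem eq_up_aHat_of_notMem {lam : Slope} (hq : Irrational (height lam)) {y : Circ}
    (hy : y ∈ cantorS lam) (h : y ∉ outsideDom lam) : y = up lam (aHat lam) :=
  eq_up_aHat (le_antisymm (cantorS_le hq hy) (not_lt.1 fun h' => h (mem_outsideDom_iff.2 h')))

/-- Continuity is not available, since the inverse branch jumps at `p`. Every other point of `C_S`
is the image of a point of `C_S` in the domain of the branch, while `p` goes back to the end `0` of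
the plateau, which is in `C_S`. -/
theorem mapsTo_outsideInv {lam : Slope} (hq : Irrational (height lam)) :
    MapsTo (outsideInv lam) (cantorS lam) (cantorS lam) := by
  intro y hy
  have h0 : outsideInv lam (plateauImage lam) ∈ cantorS lam := by
    rw [outsideInv_plateauImage]; exact (plateau_endpoints_mem hq).2.1
  rcases cantorS_subset hq hy with rfl | ⟨z, hz, rfl⟩
  · exact h0
  · by_cases h : z ∈ outsideDom lam
    · rwa [outsideInv_outsideMap h]
    · rwa [eq_up_aHat_of_notMem hq hz h, outsideMap_up_aHat]

/-! ### Extreme elements as projected backward orbits -/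

/-- The point `x_u` or `x_ℓ` of the circle. -/
def sidePoint (lam : Slope) (x : Core lam) (upper : Bool) : Circ :=
  if upper then up lam x else low lam x

theorem proj_sidePoint (lam : Slope) (x : Core lam) (u : Bool) :
    proj lam (sidePoint lam x u) = x := by
  cases u
  · exact proj_low lam x
  · exact proj_up lam x

/-- The first symbol of the extreme itinerary above `x`. -/
def extremeSymbol (lam : Slope) (x : Core lam) (upper : Bool) : Bool :=
  upper || decide (x < coreTent lam (ptA lam))

theorem up_proj_of_half_le (lam : Slope) {y : Circ} (h : 1 / 2 ≤ rep y) :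
    up lam (proj lam y) = y := by
  rcases h.lt_or_eq with h | h
  · exact up_proj lam (not_le.2 h)
  · have hy : OnLower y := h.symm.le
    have hb : y = low lam (ptB lam) := by
      rw [low, coord_ptB, ← coe_rep y, ← h]
    rw [hb, proj_low, low_ptB]

theorem lt_tent_ptA_iff {lam : Slope} {x : Core lam} :
    x < coreTent lam (ptA lam) ↔ coord lam x < 1 - lam.1 / 2 := by
  have h := sub_pos.2 (leftEnd_lt_rightEnd lam)
  rw [← coord_tent_ptA, coord, coord, div_lt_div_iff_of_pos_right (by linarith),
    sub_lt_sub_iff_right, Subtype.coe_lt_coe]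

theorem rep_outsideInv_sidePoint (lam : Slope) (x : Core lam) (u : Bool) :
    rep (outsideInv lam (sidePoint lam x u)) =
      if u then 1 / 2 - coord lam x / lam.1
      else if x < coreTent lam (ptA lam) then 1 / 2 + coord lam x / lam.1
      else (coord lam x - (1 - lam.1 / 2)) / lam.1 := by
  have hl := lam.pos
  have h1 := lam.one_lt
  obtain ⟨c0, c1⟩ := coord_mem lam x
  rw [rep_outsideInv]
  cases u
  · rw [if_neg Bool.false_ne_true, show sidePoint lam x false = low lam x from rfl, rep_low]
    simp only [lt_tent_ptA_iff]
    split_ifs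
    · field_simp; ring
    · rfl
  · rw [if_pos rfl, show sidePoint lam x true = up lam x from rfl]
    -- The glued point `a_u` has representative `0`, not `1 - coord = 1`, so it falls in the other
    -- branch of `outsideInv`.
    by_cases hx : x = ptA lam
    · subst hx
      rw [← low_ptA, rep_low, coord_ptA, if_pos (by linarith [lam.lt_two])]
      field_simp; ring
    · rw [rep_up hx, if_neg (by linarith)]
      field_simp; ring

/-- Stepping back from an upper point lands on the lower copy. From a lower point, the side changes
exactly when `x < f(a)`, where the right preimage is the only one. -/
theorem outsideInv_sidePoint (lam : Slope) (x : Core lam) (u : Bool) :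
    outsideInv lam (sidePoint lam x u) =
      sidePoint lam (proj lam (outsideInv lam (sidePoint lam x u)))
        (!u && extremeSymbol lam x u) := by
  have hl := lam.pos
  obtain ⟨c0, c1⟩ := coord_mem lam x
  have hd : 0 ≤ coord lam x / lam.1 := div_nonneg c0 hl.le
  have h := rep_outsideInv_sidePoint lam x u
  cases u
  · by_cases hx : x < coreTent lam (ptA lam)
    · simp only [hx, if_true, Bool.false_eq_true, if_false] at h
      simp only [extremeSymbol, hx, Bool.not_false, Bool.false_or, decide_true, Bool.and_self]
      exact (up_proj_of_half_le lam (by linarith)).symm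
    · simp only [hx, Bool.false_eq_true, if_false] at h
      simp only [extremeSymbol, hx, Bool.not_false, Bool.false_or, decide_false, Bool.and_false]
      refine (low_proj lam ?_).symm
      unfold OnLower
      rw [h, div_le_iff₀ hl]; linarith
  · simp only [if_true] at h
    simp only [Bool.not_true, Bool.false_and]
    refine (low_proj lam ?_).symm
    unfold OnLower
    linarith

theorem proj_le_crit_iff {lam : Slope} {y : Circ} :
    (proj lam y).1 ≤ crit ↔ min (rep y) (1 - rep y) ≤ 1 / 2 - 1 / (2 * lam.1) := by
  have hl := lam.pos
  have h := sub_pos.2 (leftEnd_lt_rightEnd lam)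
  -- The number `1/2 - 1/(2λ)` is the coordinate of the turning point on the lower copy.
  have h1 : crit = leftEnd lam + 2 * (rightEnd lam - leftEnd lam) * (1 / 2 - 1 / (2 * lam.1)) := by
    rw [crit, leftEnd_eq, rightEnd_eq]; field_simp; ring
  rw [h1]
  show leftEnd lam + _ * _ ≤ _ ↔ _
  rw [add_le_add_iff_left, mul_le_mul_iff_right₀ (by linarith)]

theorem crit_le_proj_iff {lam : Slope} {y : Circ} :
    crit ≤ (proj lam y).1 ↔ 1 / 2 - 1 / (2 * lam.1) ≤ min (rep y) (1 - rep y) := by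
  have hl := lam.pos
  have h := sub_pos.2 (leftEnd_lt_rightEnd lam)
  have h1 : crit = leftEnd lam + 2 * (rightEnd lam - leftEnd lam) * (1 / 2 - 1 / (2 * lam.1)) := by
    rw [crit, leftEnd_eq, rightEnd_eq]; field_simp; ring
  rw [h1]
  show _ ≤ leftEnd lam + _ * _ ↔ _
  rw [add_le_add_iff_left, mul_le_mul_iff_right₀ (by linarith)]

theorem extremeSymbol_spec (lam : Slope) (x : Core lam) (u : Bool) :
    (extremeSymbol lam x u = false →
      (proj lam (outsideInv lam (sidePoint lam x u))).1 ≤ crit) ∧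
    (extremeSymbol lam x u = true →
      crit ≤ (proj lam (outsideInv lam (sidePoint lam x u))).1) := by
  have hl := lam.pos
  obtain ⟨c0, c1⟩ := coord_mem lam x
  have hd : 0 ≤ coord lam x / lam.1 := div_nonneg c0 hl.le
  have hd1 : coord lam x / lam.1 ≤ 1 / (2 * lam.1) := by
    rw [div_le_div_iff₀ hl (by linarith)]; nlinarith
  have h := rep_outsideInv_sidePoint lam x u
  rw [proj_le_crit_iff, crit_le_proj_iff]
  cases u
  · by_cases hx : x < coreTent lam (ptA lam)
    · simp only [hx, if_true, Bool.false_eq_true, if_false] at h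
      simp only [extremeSymbol, hx, Bool.false_or, decide_true, Bool.true_eq_false,
        IsEmpty.forall_iff, true_and, forall_const]
      rw [h]
      exact le_min (by linarith) (by linarith)
    · simp only [hx, Bool.false_eq_true, if_false] at h
      simp only [extremeSymbol, hx, Bool.false_or, decide_false, Bool.false_eq_true,
        IsEmpty.forall_iff, and_true, forall_const]
      refine (min_le_left _ _).trans ?_
      rw [h, sub_div, sub_div]
      have : lam.1 / 2 / lam.1 = 1 / 2 := by field_simp
      have h3 : 1 / lam.1 = 1 / (2 * lam.1) + 1 / (2 * lam.1) := by field_simp; ring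
      linarith
  · simp only [if_true] at h
    simp only [extremeSymbol, Bool.true_or, Bool.true_eq_false, IsEmpty.forall_iff, true_and,
      forall_const]
    rw [h]
    exact le_min (by linarith) (by linarith)

/-- The backward orbit of a point of the circle under the outside map, projected to the inverse
limit. -/
def backwardElement (lam : Slope) (y : Circ) : InvLim lam :=
  ⟨fun r => proj lam ((outsideInv lam)^[r] y), fun r => by
    simp only [Function.iterate_succ_apply']
    rw [coreTent_proj (mem_outsideDom_iff.1 (outsideInv_mem lam _)).le, outsideMap_outsideInv]⟩

/-- The side of the `r`-th term of the backward orbit. -/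
def extremeSide (lam : Slope) (x : Core lam) (u : Bool) : ℕ → Bool
  | 0 => u
  | r + 1 => !extremeSide lam x u r &&
      extremeSymbol lam ((backwardElement lam (sidePoint lam x u)).1 r) (extremeSide lam x u r)

/-- The itinerary of the projected backward orbit. -/
def extremeItinerary (lam : Slope) (x : Core lam) (u : Bool) (r : ℕ) : Bool :=
  extremeSymbol lam ((backwardElement lam (sidePoint lam x u)).1 r) (extremeSide lam x u r)

theorem iterate_outsideInv_sidePoint (lam : Slope) (x : Core lam) (u : Bool) (r : ℕ) :
    (outsideInv lam)^[r] (sidePoint lam x u) =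
      sidePoint lam ((backwardElement lam (sidePoint lam x u)).1 r) (extremeSide lam x u r) := by
  induction r with
  | zero =>
    show _ = sidePoint lam (proj lam (sidePoint lam x u)) u
    rw [proj_sidePoint]; rfl
  | succ r ih =>
    show _ = sidePoint lam (proj lam ((outsideInv lam)^[r + 1] (sidePoint lam x u))) _
    rw [Function.iterate_succ_apply', ih]
    exact outsideInv_sidePoint lam _ _

theorem isItinerary_extremeItinerary (lam : Slope) (x : Core lam) (u : Bool) :
    IsItinerary (extremeItinerary lam x u) (backwardElement lam (sidePoint lam x u)) := by
  intro r
  have h := extremeSymbol_spec lam ((backwardElement lam (sidePoint lam x u)).1 r)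
    (extremeSide lam x u r)
  rw [← iterate_outsideInv_sidePoint, ← Function.iterate_succ_apply' (outsideInv lam)] at h
  exact h

theorem coreTent_injOn_side {lam : Slope} {x y : Core lam} (h : coreTent lam x = coreTent lam y)
    (hs : (x.1 ≤ crit ∧ y.1 ≤ crit) ∨ (crit ≤ x.1 ∧ crit ≤ y.1)) : x = y := by
  have hl := lam.pos
  have h := congrArg Subtype.val h
  simp only [coreTent, tent, crit] at h hs
  apply Subtype.ext
  rcases hs with ⟨hx, hy⟩ | ⟨hx, hy⟩
  · rw [min_eq_left (by nlinarith), min_eq_left (by nlinarith)] at h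
    exact mul_left_cancel₀ hl.ne' h
  · rw [min_eq_right (by nlinarith), min_eq_right (by nlinarith)] at h
    linarith [mul_left_cancel₀ hl.ne' h]

/-- Elements with a common base point and itineraries agreeing up to `r` agree up to `r`. -/
theorem eq_of_itinerary_agree {lam : Slope} {z w : InvLim lam} {s t : ℕ → Bool}
    (hs : IsItinerary s z) (ht : IsItinerary t w) (h0 : z.1 0 = w.1 0) (r : ℕ)
    (hr : ∀ i < r, s i = t i) : z.1 r = w.1 r := by
  induction r with
  | zero => exact h0
  | succ r ih =>
    refine coreTent_injOn_side ((z.2 r).trans ((ih fun i hi => hr i (by omega)).trans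
      (w.2 r).symm)) ?_
    have he := hr r (by omega)
    cases hv : s r
    · exact Or.inl ⟨(hs r).1 hv, (ht r).1 (he ▸ hv)⟩
    · exact Or.inr ⟨(hs r).2 hv, (ht r).2 (he ▸ hv)⟩

theorem UnimodalLE.antisymm {s t : ℕ → Bool} (h : UnimodalLE s t) (h' : UnimodalLE t s) :
    s = t := by
  rcases h with h | ⟨r, h1, h2, h3⟩
  · exact h
  rcases h' with h' | ⟨r', h1', h2', h3'⟩
  · exact h'.symm
  exact absurd (cantorCode_lt r h1 h2 h3) (cantorCode_lt r' h1' h2' h3').not_gt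

theorem IsLowerElement.unique {lam : Slope} {x : Core lam} {z w : InvLim lam}
    (hz : IsLowerElement x z) (hw : IsLowerElement x w) : z = w := by
  obtain ⟨z0, s, hs, hsm⟩ := hz
  obtain ⟨w0, t, ht, htm⟩ := hw
  obtain rfl := (hsm t ⟨w, w0, ht⟩).antisymm (htm s ⟨z, z0, hs⟩)
  exact Subtype.ext (funext fun r =>
    eq_of_itinerary_agree hs ht (z0.trans w0.symm) r fun _ _ => rfl)

theorem IsUpperElement.unique {lam : Slope} {x : Core lam} {z w : InvLim lam}
    (hz : IsUpperElement x z) (hw : IsUpperElement x w) : z = w := by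
  obtain ⟨z0, s, hs, hsm⟩ := hz
  obtain ⟨w0, t, ht, htm⟩ := hw
  obtain rfl := (htm s ⟨z, z0, hs⟩).antisymm (hsm t ⟨w, w0, ht⟩)
  exact Subtype.ext (funext fun r =>
    eq_of_itinerary_agree hs ht (z0.trans w0.symm) r fun _ _ => rfl)

/-- The side is the parity of the number of ones seen so far. -/
theorem even_sum_extremeItinerary (lam : Slope) (x : Core lam) (u : Bool) (r : ℕ) :
    Even (∑ i ∈ Finset.range r, (extremeItinerary lam x u i).toNat) ↔ extremeSide lam x u r = u := by
  induction r with
  | zero => simp [extremeSide]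
  | succ r ih =>
    have h1 : extremeSide lam x u (r + 1) =
        (!extremeSide lam x u r && extremeItinerary lam x u r) := rfl
    -- The upper side always emits a one. Hence the next side is the exclusive or of the current
    -- side and symbol, that is, the running parity.
    have h2 : extremeSide lam x u r = true → extremeItinerary lam x u r = true := by
      intro h
      rw [extremeItinerary, h]; rfl
    rw [Finset.sum_range_succ, Nat.even_add, ih, h1]
    revert h2
    generalize extremeSide lam x u r = p
    generalize extremeItinerary lam x u r = q
    cases p <;> cases q <;> cases u <;> simp

theorem coreTent_ptA_le {lam : Slope} {x : Core lam} (h : x.1 ≤ crit) :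
    coreTent lam (ptA lam) ≤ coreTent lam x := by
  have hl := lam.pos
  rw [← Subtype.coe_le_coe, tent_ptA]
  show _ ≤ min _ _
  unfold crit at h
  rw [min_eq_left (by nlinarith)]
  exact mul_le_mul_of_nonneg_left x.2.1 hl.le

/-- Up to the first difference the two elements have the same coordinates, so both symbols must be
admissible there. This rules out the forced one emitted from a lower point below `f(a)`. Every other
move ends on the lower side, which fixes the parity in terms of `u`. -/
theorem even_of_first_difference {lam : Slope} {x : Core lam} (u : Bool) {t : ℕ → Bool}
    (ht : t ∈ fiberItineraries lam x) {r : ℕ} (hr : ∀ i < r, extremeItinerary lam x u i = t i)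
    (hne : extremeItinerary lam x u r ≠ t r) :
    Even (∑ i ∈ Finset.range (r + 1), (extremeItinerary lam x u i).toNat) ↔ u = false := by
  obtain ⟨w, w0, hw⟩ := ht
  have hit := isItinerary_extremeItinerary lam x u
  have hz0 : (backwardElement lam (sidePoint lam x u)).1 0 = x := proj_sidePoint lam x u
  have hrw := eq_of_itinerary_agree hit hw (hz0.trans w0.symm) r hr
  have hside : extremeSide lam x u (r + 1) = false := by
    show (!extremeSide lam x u r && extremeItinerary lam x u r) = false
    by_contra hcon
    rw [Bool.not_eq_false, Bool.and_eq_true] at hcon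
    obtain ⟨hc1, hc2⟩ := hcon
    have htr : t r = false := by
      rw [hc2] at hne; simpa using hne.symm
    -- A point with a left preimage lies at or above `f(a)`, contradicting the forced symbol.
    have h1 := coreTent_ptA_le ((hw r).1 htr)
    rw [w.2 r, ← hrw] at h1
    rw [extremeItinerary, extremeSymbol] at hc2
    rw [Bool.not_eq_true'] at hc1
    rw [hc1, Bool.false_or, decide_eq_true_eq] at hc2
    exact absurd h1 (not_le.2 hc2)
  rw [even_sum_extremeItinerary, hside, eq_comm]

theorem isLowerElement_backwardElement (lam : Slope) (x : Core lam) :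
    IsLowerElement x (backwardElement lam (low lam x)) := by
  refine ⟨proj_low lam x, extremeItinerary lam x false, isItinerary_extremeItinerary lam x false,
    fun t ht => ?_⟩
  by_cases hst : extremeItinerary lam x false = t
  · exact Or.inl hst
  have hex : ∃ r, extremeItinerary lam x false r ≠ t r := Function.ne_iff.1 hst
  have hlt : ∀ i < Nat.find hex, extremeItinerary lam x false i = t i :=
    fun i hi => not_not.1 (Nat.find_min hex hi)
  exact Or.inr ⟨_, hlt, Nat.find_spec hex,
    (even_of_first_difference false ht hlt (Nat.find_spec hex)).2 rfl⟩

theorem isUpperElement_backwardElement (lam : Slope) (x : Core lam) :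
    IsUpperElement x (backwardElement lam (up lam x)) := by
  refine ⟨proj_up lam x, extremeItinerary lam x true, isItinerary_extremeItinerary lam x true,
    fun t ht => ?_⟩
  by_cases hst : extremeItinerary lam x true = t
  · exact Or.inl hst.symm
  have hex : ∃ r, extremeItinerary lam x true r ≠ t r := Function.ne_iff.1 hst
  have hlt : ∀ i < Nat.find hex, extremeItinerary lam x true i = t i :=
    fun i hi => not_not.1 (Nat.find_min hex hi)
  have hne := Nat.find_spec hex
  have hodd := (even_of_first_difference true ht hlt hne).not.2 (by simp)
  refine Or.inr ⟨_, fun i hi => (hlt i hi).symm, hne.symm, ?_⟩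
  -- The order tests parity on the smaller sequence, here `t`; its last symbol is flipped, which
  -- turns odd into even.
  rw [Finset.sum_range_succ] at hodd ⊢
  rw [Finset.sum_congr rfl fun i hi => by rw [← hlt i (Finset.mem_range.1 hi)]]
  exact (even_flip _ hne.symm).2 hodd

/-- Extreme elements are unique, because an itinerary and a base point determine the element. It
therefore suffices that the backward orbit realizes the extreme itinerary. -/
theorem extreme_eq (lam : Slope) (y : Circ) : extreme lam y = backwardElement lam y := by
  by_cases h : OnLower y
  · rw [← low_proj lam h]
    exact (extreme_low lam _).unique (isLowerElement_backwardElement lam _)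
  · rw [← up_proj lam h]
    exact (extreme_up lam _).unique (isUpperElement_backwardElement lam _)

theorem extreme_apply (lam : Slope) (y : Circ) (r : ℕ) :
    (extreme lam y).1 r = proj lam ((outsideInv lam)^[r] y) := by
  rw [extreme_eq]; rfl

/-! ### The natural extension on extreme elements -/

theorem natExt_zero (lam : Slope) (z : InvLim lam) :
    (natExt lam z).1 0 = coreTent lam (z.1 0) := rfl

theorem natExt_succ (lam : Slope) (z : InvLim lam) (r : ℕ) :
    (natExt lam z).1 (r + 1) = z.1 r := rfl

theorem natExt_extreme {lam : Slope} {y : Circ} (h : y ∈ outsideDom lam) :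
    natExt lam (extreme lam y) = extreme lam (outsideMap lam y) := by
  refine Subtype.ext (funext fun r => ?_)
  rw [extreme_apply]
  cases r with
  | zero =>
    rw [natExt_zero, extreme_apply]
    exact coreTent_proj (mem_outsideDom_iff.1 h).le
  | succ r =>
    rw [natExt_succ, extreme_apply, Function.iterate_succ_apply, outsideInv_outsideMap h]

theorem natExt_iterate_extreme {lam : Slope} (hq : Irrational (height lam)) (n : ℕ) :
    (natExt lam)^[n] (extreme lam (plateauImage lam)) =
      extreme lam ((outsideMap lam)^[n] (plateauImage lam)) := by
  induction n with
  | zero => rfl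
  | succ n ih =>
    rw [Function.iterate_succ_apply', Function.iterate_succ_apply', ih,
      natExt_extreme (mem_outsideDom_iff.2 (plateauOrbit_lt hq ⟨n, rfl⟩))]

theorem eq_natExt_iterate {lam : Slope} {z w : InvLim lam} (k : ℕ)
    (h : ∀ i, z.1 (i + k) = w.1 i) : z = (natExt lam)^[k] w := by
  induction k generalizing z with
  | zero => exact Subtype.ext (funext h)
  | succ k ih =>
    rw [Function.iterate_succ_apply', ← ih (z := (natExt lam).symm z) fun i => h i,
      Homeomorph.apply_symm_apply]

/-! ### Backward orbits in `C_S`: closedness, invariance and decomposition -/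

/-- Projections to the inverse limit of the backward orbits of the outside map in `cantorS`. -/
def projectedOrbits (lam : Slope) : Set (InvLim lam) :=
  {z | ∃ y : ℕ → Circ, (∀ r, y r ∈ cantorS lam ∧ outsideMap lam (y (r + 1)) = y r) ∧
    ∀ r, z.1 r = proj lam (y r)}

/-- The space of backward orbits in `C_S` is compact, and the coordinatewise projection is
continuous. -/
theorem isClosed_projectedOrbits (lam : Slope) : IsClosed (projectedOrbits lam) := by
  have hL : IsClosed {y : ℕ → Circ | ∀ r, y r ∈ cantorS lam ∧ outsideMap lam (y (r + 1)) = y r} := by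
    simp only [ofPred_forall, ofPred_and]
    refine isClosed_iInter fun r => IsClosed.inter ?_ ?_
    · exact (isClosed_cantorS lam).preimage (continuous_apply r)
    · exact isClosed_eq ((continuous_outsideMap lam).comp (continuous_apply _)) (continuous_apply r)
  have hc : Continuous fun (y : ℕ → Circ) (r : ℕ) => proj lam (y r) :=
    continuous_pi fun r => (continuous_proj lam).comp (continuous_apply r)
  convert (hL.isCompact.image hc).isClosed.preimage
    (continuous_subtype_val (p := fun x : ℕ → Core lam => ∀ r, coreTent lam (x (r + 1)) = x r))
    using 1
  ext z
  constructor
  · rintro ⟨y, hy, hz⟩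
    exact ⟨y, hy, funext fun r => (hz r).symm⟩
  · rintro ⟨y, hy, hz⟩
    exact ⟨y, hy, fun r => (congrFun hz r).symm⟩

theorem extreme_mem_projectedOrbits {lam : Slope} (hq : Irrational (height lam)) {y : Circ}
    (hy : y ∈ cantorS lam) : extreme lam y ∈ projectedOrbits lam := by
  refine ⟨fun r => (outsideInv lam)^[r] y, fun r => ⟨(mapsTo_outsideInv hq).iterate r hy, ?_⟩,
    extreme_apply lam y⟩
  simp only [Function.iterate_succ_apply']
  exact outsideMap_outsideInv lam _

theorem natExt_mem_projectedOrbits {lam : Slope} (hq : Irrational (height lam)) {z : InvLim lam}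
    (hz : z ∈ projectedOrbits lam) : natExt lam z ∈ projectedOrbits lam := by
  obtain ⟨y, hy, hz⟩ := hz
  refine ⟨fun r => Nat.casesOn r (outsideMap lam (y 0)) y, ?_, ?_⟩
  · rintro (_ | r)
    · exact ⟨mapsTo_cantorS hq (hy 0).1, rfl⟩
    · exact hy r
  · rintro (_ | r)
    · rw [natExt_zero, hz]
      exact coreTent_proj (cantorS_le hq (hy 0).1)
    · exact hz r

theorem natExt_symm_mem_projectedOrbits {lam : Slope} {z : InvLim lam}
    (hz : z ∈ projectedOrbits lam) : (natExt lam).symm z ∈ projectedOrbits lam := by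
  obtain ⟨y, hy, hz⟩ := hz
  exact ⟨fun r => y (r + 1), fun r => hy (r + 1), fun r => hz (r + 1)⟩

theorem natExt_iterate_mem_projectedOrbits {lam : Slope} (hq : Irrational (height lam))
    {z : InvLim lam} (hz : z ∈ projectedOrbits lam) (n : ℕ) :
    (natExt lam)^[n] z ∈ projectedOrbits lam :=
  (show MapsTo (natExt lam) (projectedOrbits lam) (projectedOrbits lam) from
    fun _ => natExt_mem_projectedOrbits hq).iterate n hz

theorem image_natExt_projectedOrbits {lam : Slope} (hq : Irrational (height lam)) :
    natExt lam '' projectedOrbits lam = projectedOrbits lam := by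
  refine Subset.antisymm ?_ fun z hz =>
    ⟨_, natExt_symm_mem_projectedOrbits hz, (natExt lam).apply_symm_apply z⟩
  rintro _ ⟨z, hz, rfl⟩
  exact natExt_mem_projectedOrbits hq hz

theorem iterate_backwardOrbit {lam : Slope} {y : ℕ → Circ}
    (hy : ∀ r, outsideMap lam (y (r + 1)) = y r) (n r : ℕ) :
    (outsideMap lam)^[n] (y (r + n)) = y r := by
  induction n with
  | zero => rfl
  | succ n ih => rw [Function.iterate_succ_apply, ← add_assoc, hy, ih]

theorem eq_outsideInv_iterate {lam : Slope} {y : ℕ → Circ}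
    (hy : ∀ r, outsideMap lam (y (r + 1)) = y r) {k : ℕ}
    (hdom : ∀ r, k < r → y r ∈ outsideDom lam) (i : ℕ) :
    y (i + k) = (outsideInv lam)^[i] (y k) := by
  induction i with
  | zero => simp
  | succ i ih =>
    have h := outsideInv_outsideMap (hdom (i + k + 1) (by omega))
    rw [Function.iterate_succ_apply', ← ih, show i + 1 + k = i + k + 1 by omega, ← h, hy]

/-- Since `â_u` is the only point of `C_S` outside the domain of `B̃`, a backward orbit is
determined by its zeroth term unless it passes through `â_u` at some time `k ≥ 1`. Beyond `k` it is
the backward orbit of `â_u`, and its projection is the `k`-th image of `e(â_u)`. -/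
theorem projectedOrbits_eq {lam : Slope} (hq : Irrational (height lam)) :
    projectedOrbits lam = extreme lam '' cantorS lam ∪
      {z | ∃ r : ℕ, 1 ≤ r ∧ z = (natExt lam)^[r] (extreme lam (up lam (aHat lam)))} := by
  refine Subset.antisymm ?_ (union_subset ?_ ?_)
  · rintro z ⟨y, hy, hz⟩
    have hyB := fun r => (hy r).2
    by_cases h : ∀ r, 0 < r → y r ∈ outsideDom lam
    · refine Or.inl ⟨y 0, (hy 0).1, Subtype.ext (funext fun r => ?_)⟩
      rw [extreme_apply, hz, ← eq_outsideInv_iterate hyB h]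
      rfl
    · push Not at h
      obtain ⟨k, hk, hkd⟩ := h
      have hk' := eq_up_aHat_of_notMem hq (hy k).1 hkd
      -- A second passage through `â_u` would make it periodic.
      have hdom : ∀ r, k < r → y r ∈ outsideDom lam := by
        intro r hr
        by_contra hrd
        have hr' := eq_up_aHat_of_notMem hq (hy r).1 hrd
        have h1 := iterate_backwardOrbit hyB (r - k) k
        rw [Nat.add_sub_cancel' hr.le, hk', hr'] at h1
        exact iterate_ne_self hq (Nat.sub_pos_of_lt hr) _ h1
      refine Or.inr ⟨k, hk, eq_natExt_iterate k fun i => ?_⟩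
      rw [extreme_apply, hz, eq_outsideInv_iterate hyB hdom, hk']
  · rintro _ ⟨y, hy, rfl⟩
    exact extreme_mem_projectedOrbits hq hy
  · rintro _ ⟨r, -, rfl⟩
    exact natExt_iterate_mem_projectedOrbits hq
      (extreme_mem_projectedOrbits hq (plateau_endpoints_mem hq).1) r

theorem orbit_subset {lam : Slope} (hq : Irrational (height lam)) :
    orbit (natExt lam) (extreme lam (plateauImage lam)) ⊆ extreme lam '' cantorS lam := by
  rintro _ ⟨n, rfl⟩
  exact ⟨_, plateauOrbit_subset hq ⟨n, rfl⟩, (natExt_iterate_extreme hq n).symm⟩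

/-! ### Density of the orbit -/

theorem natExt_iterate_apply {lam : Slope} (hq : Irrational (height lam)) {n i : ℕ} (h : i ≤ n) :
    ((natExt lam)^[n] (extreme lam (plateauImage lam))).1 i =
      proj lam ((outsideMap lam)^[n - i] (plateauImage lam)) := by
  rw [natExt_iterate_extreme hq, extreme_apply]
  congr 1
  induction i with
  | zero => rfl
  | succ i ih =>
    have hi : n - i = n - (i + 1) + 1 := by omega
    rw [Function.iterate_succ_apply', ih (by omega), hi, Function.iterate_succ_apply',
      outsideInv_outsideMap (mem_outsideDom_iff.2 (plateauOrbit_lt hq ⟨_, rfl⟩))]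

/-- A basic neighbourhood constrains finitely many coordinates, all images of the term `y N` under
continuous iterates of `B`. An orbit point `B^n(p)` close to `y N` then controls them all at once.
-/
theorem projectedOrbits_subset_closure {lam : Slope} (hq : Irrational (height lam)) :
    projectedOrbits lam ⊆ closure (orbit (natExt lam) (extreme lam (plateauImage lam))) := by
  rintro z ⟨y, hy, hz⟩
  rw [mem_closure_iff]
  rintro _ ⟨V, hV, rfl⟩ hzV
  obtain ⟨I, U, hU, hUV⟩ := isOpen_pi_iff.1 hV z.1 hzV
  set N := I.sup id
  have hN : ∀ i ∈ I, i ≤ N := fun i hi => Finset.le_sup (f := id) hi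
  have hW : IsOpen (⋂ i ∈ I, {x : Circ | proj lam ((outsideMap lam)^[N - i] x) ∈ U i}) :=
    isOpen_biInter_finset fun i hi => (hU i hi).1.preimage
      ((continuous_proj lam).comp ((continuous_outsideMap lam).iterate _))
  have hyN := (hy N).1
  rw [cantorS_eq hq] at hyN
  obtain ⟨_, hx, n, rfl⟩ := mem_closure_iff.1 hyN _ hW (by
    simp only [mem_iInter, mem_ofPred_eq]
    intro i hi
    have h1 := iterate_backwardOrbit (fun r => (hy r).2) (N - i) i
    rw [Nat.add_sub_cancel' (hN i hi)] at h1
    rw [h1, ← hz]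
    exact (hU i hi).2)
  simp only [mem_iInter, mem_ofPred_eq] at hx
  -- The shift by `N` puts `B^n(p)` in position `N` of the element.
  refine ⟨_, hUV fun i hi => ?_, n + N, rfl⟩
  have hi' := hN i hi
  rw [natExt_iterate_apply hq (by omega), show n + N - i = N - i + n by omega,
    Function.iterate_add_apply]
  exact hx i hi

theorem cantorC_eq {lam : Slope} (hq : Irrational (height lam)) :
    cantorC lam = projectedOrbits lam := by
  refine Subset.antisymm (closure_minimal ?_ (isClosed_projectedOrbits lam))
    ((projectedOrbits_subset_closure hq).trans (closure_mono (orbit_subset hq)))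
  rintro _ ⟨y, hy, rfl⟩
  exact extreme_mem_projectedOrbits hq hy

/-! ### Perfectness and total disconnectedness -/

theorem extreme_zero_notMem_orbit {lam : Slope} (hq : Irrational (height lam)) :
    extreme lam 0 ∉ orbit (natExt lam) (extreme lam (plateauImage lam)) := by
  rintro ⟨n, hn⟩
  have h := congrArg (fun z => z.1 0) hn
  simp only [natExt_iterate_apply hq (Nat.zero_le n), extreme_apply, Function.iterate_zero, id,
    proj_zero] at h
  exact outsideMap_ne_plateauImage hq ⟨n, eq_zero_of_proj_eq_ptA h⟩ (outsideMap_zero lam)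

/-- By density an isolated point is an orbit point `f̂^n(e(p)) = f̂^(n+1)(e(a))`. Isolation pulls
back along the homeomorphism to `e(a)`, so by density `e(a)` itself is on the orbit. Then `a` is in
the orbit of `p = B(a)`, which is impossible. -/
theorem preperfect_projectedOrbits {lam : Slope} (hq : Irrational (height lam)) :
    Preperfect (projectedOrbits lam) := by
  intro z hz
  rw [accPt_iff_nhds]
  intro U' hU'
  obtain ⟨U, hUU', hU, hzU⟩ := mem_nhds_iff.1 hU'
  by_contra! hiso
  have hiso : ∀ w ∈ U, w ∈ projectedOrbits lam → w = z := fun w hw hw' => hiso w ⟨hUU' hw, hw'⟩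
  have horb : orbit (natExt lam) (extreme lam (plateauImage lam)) ⊆ projectedOrbits lam :=
    (orbit_subset hq).trans (by rw [projectedOrbits_eq hq]; exact subset_union_left)
  have hmem : ∀ w ∈ projectedOrbits lam, ∀ V : Set (InvLim lam), IsOpen V → w ∈ V →
      ∃ x ∈ V, x ∈ orbit (natExt lam) (extreme lam (plateauImage lam)) := fun w hw V hV hwV =>
    mem_closure_iff.1 (projectedOrbits_subset_closure hq hw) V hV hwV
  obtain ⟨x, hxU, hx⟩ := hmem z hz U hU hzU
  obtain rfl := hiso x hxU (horb hx)
  obtain ⟨n, rfl⟩ := hx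
  have hpre : natExt lam (extreme lam 0) = extreme lam (plateauImage lam) := by
    rw [natExt_extreme, outsideMap_zero]
    rw [← outsideInv_plateauImage lam]
    exact outsideInv_mem lam _
  have hcont := (natExt lam).continuous.iterate (n + 1)
  have hval : (natExt lam)^[n + 1] (extreme lam 0) =
      (natExt lam)^[n] (extreme lam (plateauImage lam)) := by
    rw [Function.iterate_succ_apply, hpre]
  obtain ⟨w, hwV, hw⟩ := hmem (extreme lam 0)
    (extreme_mem_projectedOrbits hq (plateau_endpoints_mem hq).2.1) _ (hU.preimage hcont)
    (by rw [mem_preimage, hval]; exact hxU)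
  have h1 := hiso _ hwV (natExt_iterate_mem_projectedOrbits hq (horb hw) (n + 1))
  rw [← hval] at h1
  exact extreme_zero_notMem_orbit hq (((natExt lam).injective.iterate (n + 1) h1) ▸ hw)

/-- The projection is affine in `rep` on each of the two copies of `I`, so it sends null sets to
null sets. -/
theorem volume_proj_cantorS {lam : Slope} (hq : Irrational (height lam)) :
    volume ((fun y => (proj lam y).1) '' cantorS lam) = 0 := by
  set E : Set ℝ := ((↑) : ℝ → Circ) ⁻¹' cantorS lam ∩ Ico 0 1
  have hE : volume E = 0 := by
    have hK := (isClosed_cantorS lam).measurableSet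
    have h0 := (plateau_endpoints_mem hq).2.2
    -- The windows `(0, 1]` and `(-1, 0]` together cover `[0, 1)`; the second is needed only for `t
    -- = 0`.
    refine measure_mono_null ?_ (measure_union_null ((volume_eq_Ioc _ hK 0).symm.trans h0)
      ((volume_eq_Ioc _ hK (-1)).symm.trans h0))
    rintro t ⟨htK, ht0, ht1⟩
    rcases ht0.lt_or_eq with h | h
    · exact Or.inl ⟨htK, h, by linarith⟩
    · exact Or.inr ⟨htK, by linarith, by linarith⟩
  have himage : ∀ c d : ℝ, volume ((fun t : ℝ => c + d * t) '' E) = 0 := fun c d =>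
    addHaar_image_eq_zero_of_differentiableOn_of_addHaar_eq_zero volume (by fun_prop) hE
  set d := 2 * (rightEnd lam - leftEnd lam)
  refine measure_mono_null ?_
    (measure_union_null (himage (leftEnd lam) d) (himage (leftEnd lam + d) (-d)))
  rintro _ ⟨y, hy, rfl⟩
  have hyE : rep y ∈ E := ⟨by rwa [mem_preimage, coe_rep], rep_mem y⟩
  have hP : (proj lam y).1 = leftEnd lam + d * min (rep y) (1 - rep y) := rfl
  rcases min_choice (rep y) (1 - rep y) with h | h
  · exact Or.inl ⟨rep y, hyE, by simp only [hP, h]⟩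
  · exact Or.inr ⟨rep y, hyE, by simp only [hP, h]; ring⟩

theorem isTotallyDisconnected_projectedOrbits {lam : Slope} (hq : Irrational (height lam)) :
    IsTotallyDisconnected (projectedOrbits lam) := by
  intro A hA hconn z hz w hw
  refine Subtype.ext (funext fun r => Subtype.ext ?_)
  have hc : Continuous fun x : InvLim lam => (x.1 r).1 :=
    continuous_subtype_val.comp ((continuous_apply r).comp continuous_subtype_val)
  have hI := hconn.image _ hc.continuousOn
  have hnull : volume ((fun x : InvLim lam => (x.1 r).1) '' A) = 0 := by
    refine measure_mono_null ?_ (volume_proj_cantorS hq)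
    rintro _ ⟨x, hx, rfl⟩
    obtain ⟨y, hy, hxy⟩ := hA hx
    exact ⟨y r, (hy r).1, by simp only [hxy]⟩
  -- The coordinate image of a connected set contains the interval between any two of its values,
  -- and a null set contains no nondegenerate interval.
  have hle : ∀ s ∈ A, ∀ t ∈ A, (t.1 r).1 ≤ (s.1 r).1 := fun s hs t ht => by
    have h := measure_mono_null (hI.Icc_subset ⟨s, hs, rfl⟩ ⟨t, ht, rfl⟩) hnull
    rw [Real.volume_Icc, ENNReal.ofReal_eq_zero] at h
    linarith
  exact le_antisymm (hle w hw z hz) (hle z hz w hw)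

theorem isCompact_of_isClosed {lam : Slope} {X : Set (InvLim lam)} (hX : IsClosed X) :
    IsCompact X := by
  have h : IsClosed {x : ℕ → Core lam | ∀ r, coreTent lam (x (r + 1)) = x r} := by
    simp only [ofPred_forall]
    exact isClosed_iInter fun r =>
      isClosed_eq ((continuous_coreTent lam).comp (continuous_apply _)) (continuous_apply r)
  have : CompactSpace (InvLim lam) := isCompact_iff_compactSpace.1 h.isCompact
  exact hX.isCompact

theorem isCantorSet_projectedOrbits {lam : Slope} (hq : Irrational (height lam)) :
    IsCantorSet (projectedOrbits lam) :=
  ⟨⟨_, extreme_mem_projectedOrbits hq (plateauImage_mem_cantorS hq)⟩,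
    isCompact_of_isClosed (isClosed_projectedOrbits lam),
    ⟨isClosed_projectedOrbits lam, preperfect_projectedOrbits hq⟩,
    isTotallyDisconnected_projectedOrbits hq⟩

end TentMap

end

theorem mainTheorem7 (lam : TentMap.Slope) (hq : Irrational (TentMap.height lam)) :
    TentMap.IsCantorSet (TentMap.cantorC lam) ∧
    TentMap.natExt lam '' TentMap.cantorC lam = TentMap.cantorC lam ∧
    TentMap.cantorC lam =
      TentMap.extreme lam '' TentMap.cantorS lam ∪
        {z | ∃ r : ℕ, 1 ≤ r ∧
          z = (TentMap.natExt lam)^[r] (TentMap.extreme lam (TentMap.up lam (TentMap.aHat lam)))} ∧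
    TentMap.orbit (TentMap.natExt lam)
        (TentMap.extreme lam (TentMap.low lam (TentMap.coreTent lam (TentMap.ptA lam)))) ⊆
      TentMap.cantorC lam ∧
    TentMap.cantorC lam ⊆ closure (TentMap.orbit (TentMap.natExt lam)
        (TentMap.extreme lam (TentMap.low lam (TentMap.coreTent lam (TentMap.ptA lam))))) := by
  refine ⟨?_, ?_, ?_, (TentMap.orbit_subset hq).trans subset_closure, ?_⟩
  · rw [TentMap.cantorC_eq hq]
    exact TentMap.isCantorSet_projectedOrbits hq
  · rw [TentMap.cantorC_eq hq]
    exact TentMap.image_natExt_projectedOrbits hq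
  · rw [TentMap.cantorC_eq hq]
    exact TentMap.projectedOrbits_eq hq
  · rw [TentMap.cantorC_eq hq]
    exact TentMap.projectedOrbits_subset_closure hq
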